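/- Let $\mathsf{F}^{\mu}$ be the call-by-value $\lambda$-calculus with types $\tau ::= \alpha \mid \mathsf{unit} \mid \mathsf{int} \mid \mathsf{bool} \mid \tau_1\times\tau_2 \mid \tau_1+\tau_2 \mid \tau_1\to\tau_2 \mid \forall\alpha.\tau \mid \exists\alpha.\tau \mid \mu\alpha.\tau$ (impredicative polymorphism, iso-recursive types with explicit $\mathsf{fold}$ and $\mathsf{unfold}$, and the binary integer primitives $+,-,\times,=,<,\le$), with its standard typing rules and its left-to-right small-step semantics $\leadsto$. Write $e\Downarrow v$ if $e\leadsto^* v$ and $v$ is a value, and $e\Downarrow$ if $e\Downarrow v$ for some $v$. Closed terms $e_1,e_2$ are contextually equivalent at the closed type $\tau$ if both have type $\tau$ and, for every program context $C$ (a term with one hole, possibly under binders) that is well-typed as a closed program of some type $\tau'$ with a hole for closed terms of type $\tau$, we have $C[e_1]\Downarrow$ if and only if $C[e_2]\Downarrow$. Put $$\mathsf{fld}_\alpha = \mu\beta.\ \alpha\times\big((\beta\to\beta)\times(\beta\to\mathsf{bool})\big),\qquad \mathsf{flag}=\exists\alpha.\ \mathsf{fld}_\alpha .$$ Let $\mathit{not}$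 be any closed term of type $\mathsf{bool}\to\mathsf{bool}$ with $\mathit{not}\;b\Downarrow \neg b$ for both boolean constants $b$, and let $\mathit{even}$ be any closed term of type $\mathsf{int}\to\mathsf{bool}$ such that, for every integer $n$, $\mathit{even}\;n\Downarrow\mathsf{true}$ if $n$ is even and $\mathit{even}\;n\Downarrow\mathsf{false}$ if $n$ is odd. Define $$\begin{aligned} \mathit{bflag} &= \mathsf{pack}\ \mathsf{bool},\ \mathsf{fold}\,\langle \mathsf{true},\langle \mathit{bflip},\mathit{bret}\rangle\rangle\ \mathsf{as}\ \mathsf{flag},\\ \mathit{bflip} &= \lambda x{:}\mathsf{fld}_{\mathsf{bool}}.\ \mathsf{fold}\,\langle \mathit{not}\,(\mathsf{fst}(\mathsf{unfold}\,x)),\ \mathsf{snd}(\mathsf{unfold}\,x)\rangle,\\ \mathit{bret} &= \lambda x{:}\mathsf{fld}_{\mathsf{bool}}.\ \mathsf{fst}(\mathsf{unfold}\,x),\\[4pt] \mathit{iflag} &= \mathsf{pack}\ \mathsf{int},\ \mathsf{fold}\,\langle 0,\langle \mathit{iflip},\mathit{iret}\rangle\rangle\ \mathsf{as}\ \mathsf{flag},\\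 \mathit{iflip} &= \lambda x{:}\mathsf{fld}_{\mathsf{int}}.\ \mathsf{fold}\,\langle 1+\mathsf{fst}(\mathsf{unfold}\,x),\ \mathsf{snd}(\mathsf{unfold}\,x)\rangle,\\ \mathit{iret} &= \lambda x{:}\mathsf{fld}_{\mathsf{int}}.\ \mathit{even}\,(\mathsf{fst}(\mathsf{unfold}\,x)). \end{aligned}$$ Then $\mathit{bflag}$ and $\mathit{iflag}$ both have type $\mathsf{flag}$, and they are contextually equivalent at type $\mathsf{flag}$. Moreover such terms $\mathit{not}$ and $\mathit{even}$ exist: one may take $\mathit{not}=\lambda x{:}\mathsf{bool}.\ \mathsf{if}\ x\ \mathsf{then}\ \mathsf{false}\ \mathsf{else}\ \mathsf{true}$ and, for $\mathit{even}$, the recursive function (with recursion encoded through the type $\mu\beta.\,\beta\to(\mathsf{int}\to\mathsf{bool})$) that sends $x$ to $\mathsf{true}$ if $x=0$, to $\mathsf{false}$ if $x=1$, and otherwise to $\mathit{even}(x+2)$ if $x<0$ and to $\mathit{even}(x-2)$ if not. -/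

import Mathlib

namespace FMu

/-! ### Types

Types of the call-by-value calculus with impredicative polymorphism and iso-recursive types.
Bound variables are de Bruijn indices; `all`, `ex` and `mu` bind index `0`. -/

inductive Ty : Type where
  | var (i : ℕ)
  | unit
  | int
  | bool
  | prod (τ₁ τ₂ : Ty)
  | sum (τ₁ τ₂ : Ty)
  | arr (τ₁ τ₂ : Ty)
  | all (τ : Ty)
  | ex (τ : Ty)
  | mu (τ : Ty)

/-- Extension of a substitution (or renaming): index `0` goes to `x`, index `i + 1` to `σ i`. -/
def scons {X : Type} (x : X) (σ : ℕ → X) : ℕ → X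
  | 0 => x
  | i + 1 => σ i

/-- Lifting of a renaming under one binder. -/
def upRen (ξ : ℕ → ℕ) : ℕ → ℕ := scons 0 (fun i => ξ i + 1)

namespace Ty

def rename : (ℕ → ℕ) → Ty → Ty
  | ξ, var i => var (ξ i)
  | _, unit => unit
  | _, int => int
  | _, bool => bool
  | ξ, prod τ₁ τ₂ => prod (rename ξ τ₁) (rename ξ τ₂)
  | ξ, sum τ₁ τ₂ => sum (rename ξ τ₁) (rename ξ τ₂)
  | ξ, arr τ₁ τ₂ => arr (rename ξ τ₁) (rename ξ τ₂)
  | ξ, all τ => all (rename (upRen ξ) τ)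
  | ξ, ex τ => ex (rename (upRen ξ) τ)
  | ξ, mu τ => mu (rename (upRen ξ) τ)

/-- Weakening by one fresh type variable. -/
def shift (τ : Ty) : Ty := rename Nat.succ τ

/-- Lifting of a type substitution under one type binder. -/
def up (σ : ℕ → Ty) : ℕ → Ty := scons (var 0) (fun i => (σ i).shift)

/-- Simultaneous capture-avoiding substitution. -/
def subst : (ℕ → Ty) → Ty → Ty
  | σ, var i => σ i
  | _, unit => unit
  | _, int => int
  | _, bool => bool
  | σ, prod τ₁ τ₂ => prod (subst σ τ₁) (subst σ τ₂)
  | σ, sum τ₁ τ₂ => sum (subst σ τ₁) (subst σ τ₂)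
  | σ, arr τ₁ τ₂ => arr (subst σ τ₁) (subst σ τ₂)
  | σ, all τ => all (subst (up σ) τ)
  | σ, ex τ => ex (subst (up σ) τ)
  | σ, mu τ => mu (subst (up σ) τ)

/-- `τ.inst τ'` is `τ[τ'/α]`, where `α` is the variable with index `0`. -/
def inst (τ τ' : Ty) : Ty := subst (scons τ' var) τ

/-- `WF n τ`: every free variable of `τ` is one of the `n` type variables in scope. -/
def WF : ℕ → Ty → Prop
  | n, var i => i < n
  | _, unit => True
  | _, int => True
  | _, bool => True
  | n, prod τ₁ τ₂ => WF n τ₁ ∧ WF n τ₂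
  | n, sum τ₁ τ₂ => WF n τ₁ ∧ WF n τ₂
  | n, arr τ₁ τ₂ => WF n τ₁ ∧ WF n τ₂
  | n, all τ => WF (n + 1) τ
  | n, ex τ => WF (n + 1) τ
  | n, mu τ => WF (n + 1) τ

end Ty

/-! ### Primitive operations on integers -/

inductive PrimOp : Type where
  | add
  | sub
  | mul
  | eq
  | lt
  | le

/-- Result type; all arguments are of type `int`. -/
def PrimOp.resTy : PrimOp → Ty
  | add => Ty.int
  | sub => Ty.int
  | mul => Ty.int
  | eq => Ty.bool
  | lt => Ty.bool
  | le => Ty.bool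

/-! ### Terms

Type variables and term variables are two separate families of de Bruijn indices. -/

inductive Tm : Type where
  | var (i : ℕ)
  | unit
  | int (z : ℤ)
  | bool (b : Bool)
  | op (o : PrimOp) (e₁ e₂ : Tm)
  | ite (e e₁ e₂ : Tm)
  | pair (e₁ e₂ : Tm)
  | fst (e : Tm)
  | snd (e : Tm)
  /-- `inl_τ e`, where `τ` is the whole sum type -/
  | inl (τ : Ty) (e : Tm)
  /-- `inr_τ e`, where `τ` is the whole sum type -/
  | inr (τ : Ty) (e : Tm)
  /-- `case e of inl x₁ => e₁ | inr x₂ => e₂`; each branch binds one term variable -/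
  | case (e e₁ e₂ : Tm)
  /-- `λ x : τ. e` -/
  | lam (τ : Ty) (e : Tm)
  | app (e₁ e₂ : Tm)
  /-- `Λ α. e` -/
  | tlam (e : Tm)
  | tapp (e : Tm) (τ : Ty)
  /-- `pack τ₁, e as τ`, where `τ` is the whole existential type -/
  | pack (τ₁ : Ty) (e : Tm) (τ : Ty)
  /-- `unpack e₁ as α, x in e₂`; `e₂` binds one type variable and one term variable -/
  | unpack (e₁ e₂ : Tm)
  /-- `fold_τ e`, where `τ` is the whole recursive type -/
  | fold (τ : Ty) (e : Tm)
  | unfold (e : Tm)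

/-- The value of a primitive operation at two integers. -/
def PrimOp.eval : PrimOp → ℤ → ℤ → Tm
  | add, a, b => Tm.int (a + b)
  | sub, a, b => Tm.int (a - b)
  | mul, a, b => Tm.int (a * b)
  | eq, a, b => Tm.bool (decide (a = b))
  | lt, a, b => Tm.bool (decide (a < b))
  | le, a, b => Tm.bool (decide (a ≤ b))

namespace Tm

/-- Simultaneous substitution of types for type variables in a term. -/
def substTy : (ℕ → Ty) → Tm → Tm
  | _, var i => var i
  | _, unit => unit
  | _, int z => int z
  | _, bool b => bool b
  | σ, op o e₁ e₂ => op o (substTy σ e₁) (substTy σ e₂)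
  | σ, ite e e₁ e₂ => ite (substTy σ e) (substTy σ e₁) (substTy σ e₂)
  | σ, pair e₁ e₂ => pair (substTy σ e₁) (substTy σ e₂)
  | σ, fst e => fst (substTy σ e)
  | σ, snd e => snd (substTy σ e)
  | σ, inl τ e => inl (τ.subst σ) (substTy σ e)
  | σ, inr τ e => inr (τ.subst σ) (substTy σ e)
  | σ, case e e₁ e₂ => case (substTy σ e) (substTy σ e₁) (substTy σ e₂)
  | σ, lam τ e => lam (τ.subst σ) (substTy σ e)
  | σ, app e₁ e₂ => app (substTy σ e₁) (substTy σ e₂)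
  | σ, tlam e => tlam (substTy (Ty.up σ) e)
  | σ, tapp e τ => tapp (substTy σ e) (τ.subst σ)
  | σ, pack τ₁ e τ => pack (τ₁.subst σ) (substTy σ e) (τ.subst σ)
  | σ, unpack e₁ e₂ => unpack (substTy σ e₁) (substTy (Ty.up σ) e₂)
  | σ, fold τ e => fold (τ.subst σ) (substTy σ e)
  | σ, unfold e => unfold (substTy σ e)

/-- Weakening of a term by one fresh type variable. -/
def shiftTy (e : Tm) : Tm := substTy (fun i => Ty.var (i + 1)) e

/-- Renaming of the free term variables. -/
def rename : (ℕ → ℕ) → Tm → Tm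
  | ξ, var i => var (ξ i)
  | _, unit => unit
  | _, int z => int z
  | _, bool b => bool b
  | ξ, op o e₁ e₂ => op o (rename ξ e₁) (rename ξ e₂)
  | ξ, ite e e₁ e₂ => ite (rename ξ e) (rename ξ e₁) (rename ξ e₂)
  | ξ, pair e₁ e₂ => pair (rename ξ e₁) (rename ξ e₂)
  | ξ, fst e => fst (rename ξ e)
  | ξ, snd e => snd (rename ξ e)
  | ξ, inl τ e => inl τ (rename ξ e)
  | ξ, inr τ e => inr τ (rename ξ e)
  | ξ, case e e₁ e₂ => case (rename ξ e) (rename (upRen ξ) e₁) (rename (upRen ξ) e₂)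
  | ξ, lam τ e => lam τ (rename (upRen ξ) e)
  | ξ, app e₁ e₂ => app (rename ξ e₁) (rename ξ e₂)
  | ξ, tlam e => tlam (rename ξ e)
  | ξ, tapp e τ => tapp (rename ξ e) τ
  | ξ, pack τ₁ e τ => pack τ₁ (rename ξ e) τ
  | ξ, unpack e₁ e₂ => unpack (rename ξ e₁) (rename (upRen ξ) e₂)
  | ξ, fold τ e => fold τ (rename ξ e)
  | ξ, unfold e => unfold (rename ξ e)

/-- Lifting of a term substitution under one term binder. -/
def up (σ : ℕ → Tm) : ℕ → Tm := scons (var 0) (fun i => rename Nat.succ (σ i))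

/-- Lifting of a term substitution under one type binder. -/
def upTy (σ : ℕ → Tm) : ℕ → Tm := fun i => (σ i).shiftTy

/-- Simultaneous capture-avoiding substitution of terms for term variables. -/
def subst : (ℕ → Tm) → Tm → Tm
  | σ, var i => σ i
  | _, unit => unit
  | _, int z => int z
  | _, bool b => bool b
  | σ, op o e₁ e₂ => op o (subst σ e₁) (subst σ e₂)
  | σ, ite e e₁ e₂ => ite (subst σ e) (subst σ e₁) (subst σ e₂)
  | σ, pair e₁ e₂ => pair (subst σ e₁) (subst σ e₂)
  | σ, fst e => fst (subst σ e)
  | σ, snd e => snd (subst σ e)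
  | σ, inl τ e => inl τ (subst σ e)
  | σ, inr τ e => inr τ (subst σ e)
  | σ, case e e₁ e₂ => case (subst σ e) (subst (up σ) e₁) (subst (up σ) e₂)
  | σ, lam τ e => lam τ (subst (up σ) e)
  | σ, app e₁ e₂ => app (subst σ e₁) (subst σ e₂)
  | σ, tlam e => tlam (subst (upTy σ) e)
  | σ, tapp e τ => tapp (subst σ e) τ
  | σ, pack τ₁ e τ => pack τ₁ (subst σ e) τ
  | σ, unpack e₁ e₂ => unpack (subst σ e₁) (subst (up (upTy σ)) e₂)
  | σ, fold τ e => fold τ (subst σ e)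
  | σ, unfold e => unfold (subst σ e)

/-- `e.inst e'` is `e[e'/x]`, where `x` is the term variable with index `0`. -/
def inst (e e' : Tm) : Tm := subst (scons e' var) e

/-- `e.instTy τ` is `e[τ/α]`, where `α` is the type variable with index `0`. -/
def instTy (e : Tm) (τ : Ty) : Tm := substTy (scons τ Ty.var) e

end Tm

/-! ### Left-to-right call-by-value dynamic semantics -/

inductive Value : Tm → Prop
  | var (i : ℕ) : Value (Tm.var i)
  | unit : Value Tm.unit
  | int (z : ℤ) : Value (Tm.int z)
  | bool (b : Bool) : Value (Tm.bool b)
  | pair {v₁ v₂ : Tm} : Value v₁ → Value v₂ → Value (Tm.pair v₁ v₂)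
  | inl {v : Tm} (τ : Ty) : Value v → Value (Tm.inl τ v)
  | inr {v : Tm} (τ : Ty) : Value v → Value (Tm.inr τ v)
  | lam (τ : Ty) (e : Tm) : Value (Tm.lam τ e)
  | tlam (e : Tm) : Value (Tm.tlam e)
  | pack {v : Tm} (τ₁ τ : Ty) : Value v → Value (Tm.pack τ₁ v τ)
  | fold {v : Tm} (τ : Ty) : Value v → Value (Tm.fold τ v)

/-- Evaluation contexts. -/
inductive ECtx : Type where
  | hole
  | opL (o : PrimOp) (E : ECtx) (e₂ : Tm)
  | opR (o : PrimOp) (v₁ : Tm) (hv : Value v₁) (E : ECtx)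
  | ite (E : ECtx) (e₁ e₂ : Tm)
  | pairL (E : ECtx) (e₂ : Tm)
  | pairR (v₁ : Tm) (hv : Value v₁) (E : ECtx)
  | fst (E : ECtx)
  | snd (E : ECtx)
  | inl (τ : Ty) (E : ECtx)
  | inr (τ : Ty) (E : ECtx)
  | case (E : ECtx) (e₁ e₂ : Tm)
  | appL (E : ECtx) (e₂ : Tm)
  | appR (v₁ : Tm) (hv : Value v₁) (E : ECtx)
  | tapp (E : ECtx) (τ : Ty)
  | pack (τ₁ : Ty) (E : ECtx) (τ : Ty)
  | unpack (E : ECtx) (e₂ : Tm)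
  | fold (τ : Ty) (E : ECtx)
  | unfold (E : ECtx)

def ECtx.fill : ECtx → Tm → Tm
  | hole, e => e
  | opL o E e₂, e => Tm.op o (E.fill e) e₂
  | opR o v₁ _ E, e => Tm.op o v₁ (E.fill e)
  | ite E e₁ e₂, e => Tm.ite (E.fill e) e₁ e₂
  | pairL E e₂, e => Tm.pair (E.fill e) e₂
  | pairR v₁ _ E, e => Tm.pair v₁ (E.fill e)
  | fst E, e => Tm.fst (E.fill e)
  | snd E, e => Tm.snd (E.fill e)
  | inl τ E, e => Tm.inl τ (E.fill e)
  | inr τ E, e => Tm.inr τ (E.fill e)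
  | case E e₁ e₂, e => Tm.case (E.fill e) e₁ e₂
  | appL E e₂, e => Tm.app (E.fill e) e₂
  | appR v₁ _ E, e => Tm.app v₁ (E.fill e)
  | tapp E τ, e => Tm.tapp (E.fill e) τ
  | pack τ₁ E τ, e => Tm.pack τ₁ (E.fill e) τ
  | unpack E e₂, e => Tm.unpack (E.fill e) e₂
  | fold τ E, e => Tm.fold τ (E.fill e)
  | unfold E, e => Tm.unfold (E.fill e)

/-- Reduction of a redex. -/
inductive Head : Tm → Tm → Prop
  | op (o : PrimOp) (a b : ℤ) : Head (Tm.op o (Tm.int a) (Tm.int b)) (o.eval a b)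
  | iteTrue (e₁ e₂ : Tm) : Head (Tm.ite (Tm.bool true) e₁ e₂) e₁
  | iteFalse (e₁ e₂ : Tm) : Head (Tm.ite (Tm.bool false) e₁ e₂) e₂
  | fst {v₁ v₂ : Tm} : Value v₁ → Value v₂ → Head (Tm.fst (Tm.pair v₁ v₂)) v₁
  | snd {v₁ v₂ : Tm} : Value v₁ → Value v₂ → Head (Tm.snd (Tm.pair v₁ v₂)) v₂
  | caseInl {v : Tm} (τ : Ty) (e₁ e₂ : Tm) :
      Value v → Head (Tm.case (Tm.inl τ v) e₁ e₂) (e₁.inst v)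
  | caseInr {v : Tm} (τ : Ty) (e₁ e₂ : Tm) :
      Value v → Head (Tm.case (Tm.inr τ v) e₁ e₂) (e₂.inst v)
  | beta {v : Tm} (τ : Ty) (e : Tm) : Value v → Head (Tm.app (Tm.lam τ e) v) (e.inst v)
  | tbeta (e : Tm) (τ : Ty) : Head (Tm.tapp (Tm.tlam e) τ) (e.instTy τ)
  | unpack {v : Tm} (τ₁ τ : Ty) (e : Tm) :
      Value v → Head (Tm.unpack (Tm.pack τ₁ v τ) e) ((e.instTy τ₁).inst v)
  | unfold {v : Tm} (τ : Ty) : Value v → Head (Tm.unfold (Tm.fold τ v)) v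

/-- One step of reduction: a redex is reduced inside an evaluation context. -/
inductive Step : Tm → Tm → Prop
  | fill (E : ECtx) {e e' : Tm} : Head e e' → Step (E.fill e) (E.fill e')

/-- `e` evaluates to the value `v`. -/
def Evals (e v : Tm) : Prop := Relation.ReflTransGen Step e v ∧ Value v

/-- `e` terminates. -/
def Terminates (e : Tm) : Prop := ∃ v, Evals e v

/-! ### Static semantics

A typing context is given by the number `n` of type variables in scope and the list `Γ` of the
types of the term variables (innermost first), all of them types over these `n` variables.
Adding a type variable shifts the types in `Γ`. Type annotations are required to be well-formed
in the scope in which they occur. -/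

inductive HasType : ℕ → List Ty → Tm → Ty → Prop
  | var {n : ℕ} {Γ : List Ty} {i : ℕ} {τ : Ty} : Γ[i]? = some τ → HasType n Γ (Tm.var i) τ
  | unit {n : ℕ} {Γ : List Ty} : HasType n Γ Tm.unit Ty.unit
  | int {n : ℕ} {Γ : List Ty} (z : ℤ) : HasType n Γ (Tm.int z) Ty.int
  | bool {n : ℕ} {Γ : List Ty} (b : Bool) : HasType n Γ (Tm.bool b) Ty.bool
  | op {n : ℕ} {Γ : List Ty} {e₁ e₂ : Tm} (o : PrimOp) :
      HasType n Γ e₁ Ty.int → HasType n Γ e₂ Ty.int → HasType n Γ (Tm.op o e₁ e₂) o.resTy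
  | ite {n : ℕ} {Γ : List Ty} {e e₁ e₂ : Tm} {τ : Ty} :
      HasType n Γ e Ty.bool → HasType n Γ e₁ τ → HasType n Γ e₂ τ →
      HasType n Γ (Tm.ite e e₁ e₂) τ
  | pair {n : ℕ} {Γ : List Ty} {e₁ e₂ : Tm} {τ₁ τ₂ : Ty} :
      HasType n Γ e₁ τ₁ → HasType n Γ e₂ τ₂ → HasType n Γ (Tm.pair e₁ e₂) (Ty.prod τ₁ τ₂)
  | fst {n : ℕ} {Γ : List Ty} {e : Tm} {τ₁ τ₂ : Ty} :
      HasType n Γ e (Ty.prod τ₁ τ₂) → HasType n Γ (Tm.fst e) τ₁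
  | snd {n : ℕ} {Γ : List Ty} {e : Tm} {τ₁ τ₂ : Ty} :
      HasType n Γ e (Ty.prod τ₁ τ₂) → HasType n Γ (Tm.snd e) τ₂
  | inl {n : ℕ} {Γ : List Ty} {e : Tm} {τ₁ τ₂ : Ty} :
      HasType n Γ e τ₁ → Ty.WF n τ₂ → HasType n Γ (Tm.inl (Ty.sum τ₁ τ₂) e) (Ty.sum τ₁ τ₂)
  | inr {n : ℕ} {Γ : List Ty} {e : Tm} {τ₁ τ₂ : Ty} :
      HasType n Γ e τ₂ → Ty.WF n τ₁ → HasType n Γ (Tm.inr (Ty.sum τ₁ τ₂) e) (Ty.sum τ₁ τ₂)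
  | case {n : ℕ} {Γ : List Ty} {e e₁ e₂ : Tm} {τ₁ τ₂ τ : Ty} :
      HasType n Γ e (Ty.sum τ₁ τ₂) → HasType n (τ₁ :: Γ) e₁ τ → HasType n (τ₂ :: Γ) e₂ τ →
      HasType n Γ (Tm.case e e₁ e₂) τ
  | lam {n : ℕ} {Γ : List Ty} {e : Tm} {τ₁ τ₂ : Ty} :
      Ty.WF n τ₁ → HasType n (τ₁ :: Γ) e τ₂ → HasType n Γ (Tm.lam τ₁ e) (Ty.arr τ₁ τ₂)
  | app {n : ℕ} {Γ : List Ty} {e₁ e₂ : Tm} {τ₂ τ : Ty} :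
      HasType n Γ e₁ (Ty.arr τ₂ τ) → HasType n Γ e₂ τ₂ → HasType n Γ (Tm.app e₁ e₂) τ
  | tlam {n : ℕ} {Γ : List Ty} {e : Tm} {τ : Ty} :
      HasType (n + 1) (Γ.map Ty.shift) e τ → HasType n Γ (Tm.tlam e) (Ty.all τ)
  | tapp {n : ℕ} {Γ : List Ty} {e : Tm} {τ τ₁ : Ty} :
      HasType n Γ e (Ty.all τ) → Ty.WF n τ₁ → HasType n Γ (Tm.tapp e τ₁) (τ.inst τ₁)
  | pack {n : ℕ} {Γ : List Ty} {e : Tm} {τ₁ τ : Ty} :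
      Ty.WF n τ₁ → HasType n Γ e (τ.inst τ₁) →
      HasType n Γ (Tm.pack τ₁ e (Ty.ex τ)) (Ty.ex τ)
  | unpack {n : ℕ} {Γ : List Ty} {e₁ e₂ : Tm} {τ₁ τ : Ty} :
      HasType n Γ e₁ (Ty.ex τ₁) → Ty.WF n τ →
      HasType (n + 1) (τ₁ :: Γ.map Ty.shift) e₂ τ.shift → HasType n Γ (Tm.unpack e₁ e₂) τ
  | fold {n : ℕ} {Γ : List Ty} {e : Tm} {τ : Ty} :
      HasType n Γ e (τ.inst (Ty.mu τ)) → Ty.WF n (Ty.mu τ) →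
      HasType n Γ (Tm.fold (Ty.mu τ) e) (Ty.mu τ)
  | unfold {n : ℕ} {Γ : List Ty} {e : Tm} {τ : Ty} :
      HasType n Γ e (Ty.mu τ) → HasType n Γ (Tm.unfold e) (τ.inst (Ty.mu τ))

/-! ### Program contexts and contextual equivalence of closed terms -/

/-- Program contexts: terms with exactly one hole, which may lie under binders. -/
inductive Ctx : Type where
  | hole
  | opL (o : PrimOp) (C : Ctx) (e₂ : Tm)
  | opR (o : PrimOp) (e₁ : Tm) (C : Ctx)
  | iteC (C : Ctx) (e₁ e₂ : Tm)
  | iteL (e : Tm) (C : Ctx) (e₂ : Tm)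
  | iteR (e e₁ : Tm) (C : Ctx)
  | pairL (C : Ctx) (e₂ : Tm)
  | pairR (e₁ : Tm) (C : Ctx)
  | fst (C : Ctx)
  | snd (C : Ctx)
  | inl (τ : Ty) (C : Ctx)
  | inr (τ : Ty) (C : Ctx)
  | caseC (C : Ctx) (e₁ e₂ : Tm)
  | caseL (e : Tm) (C : Ctx) (e₂ : Tm)
  | caseR (e e₁ : Tm) (C : Ctx)
  | lam (τ : Ty) (C : Ctx)
  | appL (C : Ctx) (e₂ : Tm)
  | appR (e₁ : Tm) (C : Ctx)
  | tlam (C : Ctx)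
  | tapp (C : Ctx) (τ : Ty)
  | pack (τ₁ : Ty) (C : Ctx) (τ : Ty)
  | unpackL (C : Ctx) (e₂ : Tm)
  | unpackR (e₁ : Tm) (C : Ctx)
  | fold (τ : Ty) (C : Ctx)
  | unfold (C : Ctx)

/-- `C.plug e` is `C[e]`. It is only used for closed `e`, so that no index of `e` has to be
adjusted when the hole lies under binders. -/
def Ctx.plug : Ctx → Tm → Tm
  | hole, e => e
  | opL o C e₂, e => Tm.op o (C.plug e) e₂
  | opR o e₁ C, e => Tm.op o e₁ (C.plug e)
  | iteC C e₁ e₂, e => Tm.ite (C.plug e) e₁ e₂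
  | iteL e₀ C e₂, e => Tm.ite e₀ (C.plug e) e₂
  | iteR e₀ e₁ C, e => Tm.ite e₀ e₁ (C.plug e)
  | pairL C e₂, e => Tm.pair (C.plug e) e₂
  | pairR e₁ C, e => Tm.pair e₁ (C.plug e)
  | fst C, e => Tm.fst (C.plug e)
  | snd C, e => Tm.snd (C.plug e)
  | inl τ C, e => Tm.inl τ (C.plug e)
  | inr τ C, e => Tm.inr τ (C.plug e)
  | caseC C e₁ e₂, e => Tm.case (C.plug e) e₁ e₂
  | caseL e₀ C e₂, e => Tm.case e₀ (C.plug e) e₂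
  | caseR e₀ e₁ C, e => Tm.case e₀ e₁ (C.plug e)
  | lam τ C, e => Tm.lam τ (C.plug e)
  | appL C e₂, e => Tm.app (C.plug e) e₂
  | appR e₁ C, e => Tm.app e₁ (C.plug e)
  | tlam C, e => Tm.tlam (C.plug e)
  | tapp C τ, e => Tm.tapp (C.plug e) τ
  | pack τ₁ C τ, e => Tm.pack τ₁ (C.plug e) τ
  | unpackL C e₂, e => Tm.unpack (C.plug e) e₂
  | unpackR e₁ C, e => Tm.unpack e₁ (C.plug e)
  | fold τ C, e => Tm.fold τ (C.plug e)
  | unfold C, e => Tm.unfold (C.plug e)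

/-- `CtxHasType τ₀ C n Γ τ` is the context typing `⊢ C : (· ▷ τ₀) ⇝ (n; Γ ▷ τ)`: the hole takes a
closed term of the closed type `τ₀`. As the empty context is included in every context, the hole
may occur in any scope. -/
inductive CtxHasType (τ₀ : Ty) : Ctx → ℕ → List Ty → Ty → Prop
  | hole {n : ℕ} {Γ : List Ty} : CtxHasType τ₀ Ctx.hole n Γ τ₀
  | opL {n : ℕ} {Γ : List Ty} {C : Ctx} {e₂ : Tm} (o : PrimOp) :
      CtxHasType τ₀ C n Γ Ty.int → HasType n Γ e₂ Ty.int →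
      CtxHasType τ₀ (Ctx.opL o C e₂) n Γ o.resTy
  | opR {n : ℕ} {Γ : List Ty} {C : Ctx} {e₁ : Tm} (o : PrimOp) :
      HasType n Γ e₁ Ty.int → CtxHasType τ₀ C n Γ Ty.int →
      CtxHasType τ₀ (Ctx.opR o e₁ C) n Γ o.resTy
  | iteC {n : ℕ} {Γ : List Ty} {C : Ctx} {e₁ e₂ : Tm} {τ : Ty} :
      CtxHasType τ₀ C n Γ Ty.bool → HasType n Γ e₁ τ → HasType n Γ e₂ τ →
      CtxHasType τ₀ (Ctx.iteC C e₁ e₂) n Γ τ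
  | iteL {n : ℕ} {Γ : List Ty} {C : Ctx} {e e₂ : Tm} {τ : Ty} :
      HasType n Γ e Ty.bool → CtxHasType τ₀ C n Γ τ → HasType n Γ e₂ τ →
      CtxHasType τ₀ (Ctx.iteL e C e₂) n Γ τ
  | iteR {n : ℕ} {Γ : List Ty} {C : Ctx} {e e₁ : Tm} {τ : Ty} :
      HasType n Γ e Ty.bool → HasType n Γ e₁ τ → CtxHasType τ₀ C n Γ τ →
      CtxHasType τ₀ (Ctx.iteR e e₁ C) n Γ τ
  | pairL {n : ℕ} {Γ : List Ty} {C : Ctx} {e₂ : Tm} {τ₁ τ₂ : Ty} :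
      CtxHasType τ₀ C n Γ τ₁ → HasType n Γ e₂ τ₂ →
      CtxHasType τ₀ (Ctx.pairL C e₂) n Γ (Ty.prod τ₁ τ₂)
  | pairR {n : ℕ} {Γ : List Ty} {C : Ctx} {e₁ : Tm} {τ₁ τ₂ : Ty} :
      HasType n Γ e₁ τ₁ → CtxHasType τ₀ C n Γ τ₂ →
      CtxHasType τ₀ (Ctx.pairR e₁ C) n Γ (Ty.prod τ₁ τ₂)
  | fst {n : ℕ} {Γ : List Ty} {C : Ctx} {τ₁ τ₂ : Ty} :
      CtxHasType τ₀ C n Γ (Ty.prod τ₁ τ₂) → CtxHasType τ₀ (Ctx.fst C) n Γ τ₁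
  | snd {n : ℕ} {Γ : List Ty} {C : Ctx} {τ₁ τ₂ : Ty} :
      CtxHasType τ₀ C n Γ (Ty.prod τ₁ τ₂) → CtxHasType τ₀ (Ctx.snd C) n Γ τ₂
  | inl {n : ℕ} {Γ : List Ty} {C : Ctx} {τ₁ τ₂ : Ty} :
      CtxHasType τ₀ C n Γ τ₁ → Ty.WF n τ₂ →
      CtxHasType τ₀ (Ctx.inl (Ty.sum τ₁ τ₂) C) n Γ (Ty.sum τ₁ τ₂)
  | inr {n : ℕ} {Γ : List Ty} {C : Ctx} {τ₁ τ₂ : Ty} :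
      CtxHasType τ₀ C n Γ τ₂ → Ty.WF n τ₁ →
      CtxHasType τ₀ (Ctx.inr (Ty.sum τ₁ τ₂) C) n Γ (Ty.sum τ₁ τ₂)
  | caseC {n : ℕ} {Γ : List Ty} {C : Ctx} {e₁ e₂ : Tm} {τ₁ τ₂ τ : Ty} :
      CtxHasType τ₀ C n Γ (Ty.sum τ₁ τ₂) → HasType n (τ₁ :: Γ) e₁ τ →
      HasType n (τ₂ :: Γ) e₂ τ → CtxHasType τ₀ (Ctx.caseC C e₁ e₂) n Γ τ
  | caseL {n : ℕ} {Γ : List Ty} {C : Ctx} {e e₂ : Tm} {τ₁ τ₂ τ : Ty} :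
      HasType n Γ e (Ty.sum τ₁ τ₂) → CtxHasType τ₀ C n (τ₁ :: Γ) τ →
      HasType n (τ₂ :: Γ) e₂ τ → CtxHasType τ₀ (Ctx.caseL e C e₂) n Γ τ
  | caseR {n : ℕ} {Γ : List Ty} {C : Ctx} {e e₁ : Tm} {τ₁ τ₂ τ : Ty} :
      HasType n Γ e (Ty.sum τ₁ τ₂) → HasType n (τ₁ :: Γ) e₁ τ →
      CtxHasType τ₀ C n (τ₂ :: Γ) τ → CtxHasType τ₀ (Ctx.caseR e e₁ C) n Γ τ
  | lam {n : ℕ} {Γ : List Ty} {C : Ctx} {τ₁ τ₂ : Ty} :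
      Ty.WF n τ₁ → CtxHasType τ₀ C n (τ₁ :: Γ) τ₂ →
      CtxHasType τ₀ (Ctx.lam τ₁ C) n Γ (Ty.arr τ₁ τ₂)
  | appL {n : ℕ} {Γ : List Ty} {C : Ctx} {e₂ : Tm} {τ₂ τ : Ty} :
      CtxHasType τ₀ C n Γ (Ty.arr τ₂ τ) → HasType n Γ e₂ τ₂ →
      CtxHasType τ₀ (Ctx.appL C e₂) n Γ τ
  | appR {n : ℕ} {Γ : List Ty} {C : Ctx} {e₁ : Tm} {τ₂ τ : Ty} :
      HasType n Γ e₁ (Ty.arr τ₂ τ) → CtxHasType τ₀ C n Γ τ₂ →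
      CtxHasType τ₀ (Ctx.appR e₁ C) n Γ τ
  | tlam {n : ℕ} {Γ : List Ty} {C : Ctx} {τ : Ty} :
      CtxHasType τ₀ C (n + 1) (Γ.map Ty.shift) τ → CtxHasType τ₀ (Ctx.tlam C) n Γ (Ty.all τ)
  | tapp {n : ℕ} {Γ : List Ty} {C : Ctx} {τ τ₁ : Ty} :
      CtxHasType τ₀ C n Γ (Ty.all τ) → Ty.WF n τ₁ →
      CtxHasType τ₀ (Ctx.tapp C τ₁) n Γ (τ.inst τ₁)
  | pack {n : ℕ} {Γ : List Ty} {C : Ctx} {τ₁ τ : Ty} :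
      Ty.WF n τ₁ → CtxHasType τ₀ C n Γ (τ.inst τ₁) →
      CtxHasType τ₀ (Ctx.pack τ₁ C (Ty.ex τ)) n Γ (Ty.ex τ)
  | unpackL {n : ℕ} {Γ : List Ty} {C : Ctx} {e₂ : Tm} {τ₁ τ : Ty} :
      CtxHasType τ₀ C n Γ (Ty.ex τ₁) → Ty.WF n τ →
      HasType (n + 1) (τ₁ :: Γ.map Ty.shift) e₂ τ.shift →
      CtxHasType τ₀ (Ctx.unpackL C e₂) n Γ τ
  | unpackR {n : ℕ} {Γ : List Ty} {C : Ctx} {e₁ : Tm} {τ₁ τ : Ty} :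
      HasType n Γ e₁ (Ty.ex τ₁) → Ty.WF n τ →
      CtxHasType τ₀ C (n + 1) (τ₁ :: Γ.map Ty.shift) τ.shift →
      CtxHasType τ₀ (Ctx.unpackR e₁ C) n Γ τ
  | fold {n : ℕ} {Γ : List Ty} {C : Ctx} {τ : Ty} :
      CtxHasType τ₀ C n Γ (τ.inst (Ty.mu τ)) → Ty.WF n (Ty.mu τ) →
      CtxHasType τ₀ (Ctx.fold (Ty.mu τ) C) n Γ (Ty.mu τ)
  | unfold {n : ℕ} {Γ : List Ty} {C : Ctx} {τ : Ty} :
      CtxHasType τ₀ C n Γ (Ty.mu τ) → CtxHasType τ₀ (Ctx.unfold C) n Γ (τ.inst (Ty.mu τ))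

/-- Contextual approximation at the closed type `τ`, for closed terms of that type. -/
def CtxApprox (e₁ e₂ : Tm) (τ : Ty) : Prop :=
  ∀ (C : Ctx) (τ' : Ty), CtxHasType τ C 0 [] τ' →
    Terminates (C.plug e₁) → Terminates (C.plug e₂)

/-- Contextual equivalence at the closed type `τ`, for closed terms of that type: both terms have
type `τ`, and each approximates the other. -/
def CtxEquiv (e₁ e₂ : Tm) (τ : Ty) : Prop :=
  (HasType 0 [] e₁ τ ∧ HasType 0 [] e₂ τ) ∧ CtxApprox e₁ e₂ τ ∧ CtxApprox e₂ e₁ τ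

/-! ### Boolean negation and parity -/

/-- `e` is a closed term of type `bool → bool` that computes negation. -/
def ImplementsNot (e : Tm) : Prop :=
  HasType 0 [] e (Ty.arr Ty.bool Ty.bool) ∧
    ∀ b : Bool, Evals (Tm.app e (Tm.bool b)) (Tm.bool (!b))

/-- `e` is a closed term of type `int → bool` that decides evenness. -/
def ImplementsEven (e : Tm) : Prop :=
  HasType 0 [] e (Ty.arr Ty.int Ty.bool) ∧
    ∀ z : ℤ, Evals (Tm.app e (Tm.int z)) (Tm.bool (decide (Even z)))

/-- `λ x : bool. if x then false else true` -/
def notTm : Tm := Tm.lam Ty.bool (Tm.ite (Tm.var 0) (Tm.bool false) (Tm.bool true))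

/-- The recursive type `μ β. β → (int → bool)`, used for self-application. -/
def selfTy : Ty := Ty.mu (Ty.arr (Ty.var 0) (Ty.arr Ty.int Ty.bool))

/-- `λ f : μ β. β → (int → bool). λ x : int. if x = 0 then true else if x = 1 then false else
if x < 0 then (unfold f) f (x + 2) else (unfold f) f (x - 2)` -/
def evenBody : Tm :=
  Tm.lam selfTy (Tm.lam Ty.int
    (Tm.ite (Tm.op PrimOp.eq (Tm.var 0) (Tm.int 0)) (Tm.bool true)
      (Tm.ite (Tm.op PrimOp.eq (Tm.var 0) (Tm.int 1)) (Tm.bool false)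
        (Tm.ite (Tm.op PrimOp.lt (Tm.var 0) (Tm.int 0))
          (Tm.app (Tm.app (Tm.unfold (Tm.var 1)) (Tm.var 1))
            (Tm.op PrimOp.add (Tm.var 0) (Tm.int 2)))
          (Tm.app (Tm.app (Tm.unfold (Tm.var 1)) (Tm.var 1))
            (Tm.op PrimOp.sub (Tm.var 0) (Tm.int 2)))))))

/-- The recursive function `even : int → bool`. -/
def evenTm : Tm :=
  Tm.lam Ty.int (Tm.app (Tm.app evenBody (Tm.fold selfTy evenBody)) (Tm.var 0))

/-! ### Flag objects

The closed terms `not` and `even` used by the methods are parameters of the definitions. -/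

/-- `fld_α = μ β. α × ((β → β) × (β → bool))` -/
def fldTy (α : Ty) : Ty :=
  Ty.mu (Ty.prod α.shift
    (Ty.prod (Ty.arr (Ty.var 0) (Ty.var 0)) (Ty.arr (Ty.var 0) Ty.bool)))

/-- `flag = ∃ α. fld_α` -/
def flagTy : Ty := Ty.ex (fldTy (Ty.var 0))

/-- `λ x : fld_bool. fold ⟨not (fst (unfold x)), snd (unfold x)⟩` -/
def bflip (neg : Tm) : Tm :=
  Tm.lam (fldTy Ty.bool) (Tm.fold (fldTy Ty.bool)
    (Tm.pair (Tm.app neg (Tm.fst (Tm.unfold (Tm.var 0)))) (Tm.snd (Tm.unfold (Tm.var 0)))))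

/-- `λ x : fld_bool. fst (unfold x)` -/
def bret : Tm := Tm.lam (fldTy Ty.bool) (Tm.fst (Tm.unfold (Tm.var 0)))

/-- `pack bool, fold ⟨true, ⟨bflip, bret⟩⟩ as flag` -/
def bflag (neg : Tm) : Tm :=
  Tm.pack Ty.bool
    (Tm.fold (fldTy Ty.bool) (Tm.pair (Tm.bool true) (Tm.pair (bflip neg) bret))) flagTy

/-- `λ x : fld_int. fold ⟨1 + fst (unfold x), snd (unfold x)⟩` -/
def iflip : Tm :=
  Tm.lam (fldTy Ty.int) (Tm.fold (fldTy Ty.int)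
    (Tm.pair (Tm.op PrimOp.add (Tm.int 1) (Tm.fst (Tm.unfold (Tm.var 0))))
      (Tm.snd (Tm.unfold (Tm.var 0)))))

/-- `λ x : fld_int. even (fst (unfold x))` -/
def iret (ev : Tm) : Tm :=
  Tm.lam (fldTy Ty.int) (Tm.app ev (Tm.fst (Tm.unfold (Tm.var 0))))

/-- `pack int, fold ⟨0, ⟨iflip, iret⟩⟩ as flag` -/
def iflag (ev : Tm) : Tm :=
  Tm.pack Ty.int
    (Tm.fold (fldTy Ty.int) (Tm.pair (Tm.int 0) (Tm.pair iflip (iret ev)))) flagTy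

end FMu

/-!
The proof replaces logical relations by a typed simulation. The relation `FlagRel` is a typing
judgement for pairs of terms, with one type variable `k` set aside as the hidden state type of the
flag objects: at type `var k` the boolean `Even z` is related to the integer `z`, and at the method
types over `var k` the methods `bflip`, `bret` are related to `iflip`, `iret`. All other rules are
the typing rules, read for two terms of the same shape whose annotations may differ. Packing the
state type as `var k` relates the two flag objects (`flagRel_flags`), hence also any two programs
that arise from one context by plugging them in (`CtxHasType.flagRel`).

Related closed terms are both values, or both reduce in at least one step to related terms
(`FlagRel.simulation`). This is progress and preservation in one induction. Since a term of type
`var k` cannot be inspected by a typed context, the only steps in which the two sides differ are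
calls of the methods, and there the invariant `Even (1 + z) ↔ ¬ Even z` is what is needed.
As reduction is deterministic, such a simulation transports termination in either direction
(`Terminates.of_simulation`), so no step index is needed.

Preservation rests on the stability of `FlagRel` under substitution of types and of terms. For
the rules about the methods this uses that the closed terms `neg` and `ev` are unchanged by
substitution, which follows from their typing (`HasType.substTy_eq`, `HasType.subst_eq`).
Being arbitrary closed terms, they need not be values, so a call to one of them may first evaluate
the function itself (`Evals.app_steps`).
-/

namespace FMu

/-! ### Substitution in types -/

theorem upRen_comp (ξ ζ : ℕ → ℕ) : (fun i => upRen ζ (upRen ξ i)) = upRen (fun i => ζ (ξ i)) := by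
  funext i; cases i <;> rfl

namespace Ty

theorem up_upRen (ξ : ℕ → ℕ) (σ : ℕ → Ty) :
    (fun i => up σ (upRen ξ i)) = up (fun i => σ (ξ i)) := by
  funext i; cases i <;> rfl

theorem rename_rename (τ : Ty) (ξ ζ : ℕ → ℕ) :
    (τ.rename ξ).rename ζ = τ.rename (fun i => ζ (ξ i)) := by
  induction τ generalizing ξ ζ <;> simp_all [rename, upRen_comp]

theorem subst_rename (τ : Ty) (ξ : ℕ → ℕ) (σ : ℕ → Ty) :
    (τ.rename ξ).subst σ = τ.subst (fun i => σ (ξ i)) := by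
  induction τ generalizing ξ σ <;> simp_all [rename, subst, up_upRen]

theorem rename_up (σ : ℕ → Ty) (ξ : ℕ → ℕ) :
    (fun i => (up σ i).rename (upRen ξ)) = up (fun i => (σ i).rename ξ) := by
  funext i
  cases i with
  | zero => rfl
  | succ i => simp [up, scons, shift, rename_rename, upRen]

theorem rename_subst (τ : Ty) (σ : ℕ → Ty) (ξ : ℕ → ℕ) :
    (τ.subst σ).rename ξ = τ.subst (fun i => (σ i).rename ξ) := by
  induction τ generalizing ξ σ <;> simp_all [rename, subst, rename_up]

theorem shift_subst_up (τ : Ty) (σ : ℕ → Ty) : τ.shift.subst (up σ) = (τ.subst σ).shift := by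
  simp only [shift, subst_rename, rename_subst]
  rfl

theorem subst_up (σ ρ : ℕ → Ty) :
    (fun i => (up σ i).subst (up ρ)) = up (fun i => (σ i).subst ρ) := by
  funext i
  cases i with
  | zero => rfl
  | succ i => exact shift_subst_up _ _

theorem subst_subst (τ : Ty) (σ ρ : ℕ → Ty) :
    (τ.subst σ).subst ρ = τ.subst (fun i => (σ i).subst ρ) := by
  induction τ generalizing σ ρ <;> simp_all [subst, subst_up]

theorem up_var : up var = var := by
  funext i; cases i <;> rfl

theorem subst_var (τ : Ty) : τ.subst var = τ := by
  induction τ <;> simp_all [subst, up_var]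

theorem shift_inst (τ τ' : Ty) : τ.shift.inst τ' = τ := by
  simp only [shift, inst, subst_rename]
  exact subst_var τ

theorem rename_eq_subst (τ : Ty) (ξ : ℕ → ℕ) : τ.rename ξ = τ.subst (fun i => var (ξ i)) := by
  have h := rename_subst τ var ξ
  rwa [subst_var] at h

theorem inst_subst (τ τ' : Ty) (σ : ℕ → Ty) :
    (τ.inst τ').subst σ = (τ.subst (up σ)).inst (τ'.subst σ) := by
  simp only [inst, subst_subst]
  congr 1
  funext i
  cases i with
  | zero => rfl
  | succ i => exact (shift_inst (σ i) (τ'.subst σ)).symm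

/-! ### Well-formed types -/

theorem WF.rename {τ : Ty} {n m : ℕ} {ξ : ℕ → ℕ} (h : WF n τ) (hξ : ∀ i < n, ξ i < m) :
    WF m (τ.rename ξ) := by
  have hup : ∀ {n m : ℕ} {ξ : ℕ → ℕ}, (∀ i < n, ξ i < m) →
      ∀ i < n + 1, upRen ξ i < m + 1 := by
    intro n m ξ h i hi
    cases i with
    | zero => exact Nat.succ_pos m
    | succ i => exact Nat.succ_lt_succ (h i (Nat.lt_of_succ_lt_succ hi))
  induction τ generalizing n m ξ <;> simp only [WF, Ty.rename] at * <;> grind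

theorem WF.shift {τ : Ty} {n : ℕ} (h : WF n τ) : WF (n + 1) τ.shift :=
  h.rename fun _ hi => Nat.succ_lt_succ hi

theorem WF.subst {τ : Ty} {n m : ℕ} {σ : ℕ → Ty} (h : WF n τ)
    (hσ : ∀ i < n, WF m (σ i)) : WF m (τ.subst σ) := by
  have hup : ∀ {n m : ℕ} {σ : ℕ → Ty}, (∀ i < n, WF m (σ i)) →
      ∀ i < n + 1, WF (m + 1) (up σ i) := by
    intro n m σ h i hi
    cases i with
    | zero => exact Nat.succ_pos m
    | succ i => exact (h i (Nat.lt_of_succ_lt_succ hi)).shift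
  induction τ generalizing n m σ with
  | all τ ih | ex τ ih | mu τ ih => exact ih (n := n + 1) h (hup hσ)
  | _ => simp only [WF, Ty.subst] at * <;> grind

theorem WF.inst {τ τ' : Ty} {n : ℕ} (h : WF (n + 1) τ) (h' : WF n τ') : WF n (τ.inst τ') := by
  refine h.subst fun i hi => ?_
  cases i with
  | zero => exact h'
  | succ i => exact Nat.lt_of_succ_lt_succ hi

theorem WF.of_rename {τ : Ty} {n m : ℕ} {ξ : ℕ → ℕ} (h : WF m (τ.rename ξ))
    (hξ : ∀ i, ξ i < m → i < n) : WF n τ := by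
  have hu : ∀ {n m : ℕ} {ξ : ℕ → ℕ}, (∀ i, ξ i < m → i < n) →
      ∀ i, upRen ξ i < m + 1 → i < n + 1 := by
    intro n m ξ h i hi
    cases i with
    | zero => exact Nat.succ_pos n
    | succ i => exact Nat.succ_lt_succ (h i (Nat.lt_of_succ_lt_succ hi))
  induction τ generalizing n m ξ <;> simp only [WF, Ty.rename] at * <;> grind

theorem WF.of_shift {τ : Ty} {n : ℕ} (h : WF (n + 1) τ.shift) : WF n τ :=
  h.of_rename fun _ hi => Nat.lt_of_succ_lt_succ hi

theorem WF.of_subst {τ : Ty} {n m : ℕ} {σ : ℕ → Ty} (h : WF m (τ.subst σ))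
    (hσ : ∀ i, WF m (σ i) → i < n) : WF n τ := by
  have hup : ∀ {n m : ℕ} {σ : ℕ → Ty}, (∀ i, WF m (σ i) → i < n) →
      ∀ i, WF (m + 1) (up σ i) → i < n + 1 := by
    intro n m σ h i hi
    cases i with
    | zero => exact Nat.succ_pos n
    | succ i => exact Nat.succ_lt_succ (h i hi.of_shift)
  induction τ generalizing n m σ with
  | all τ ih | ex τ ih | mu τ ih => exact ih h (hup hσ)
  | _ => simp only [WF, Ty.subst] at * <;> grind

theorem WF.of_inst {τ τ' : Ty} {n : ℕ} (h : WF n (τ.inst τ')) : WF (n + 1) τ := by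
  refine h.of_subst fun i hi => ?_
  cases i with
  | zero => exact Nat.succ_pos n
  | succ i => exact Nat.succ_lt_succ hi

theorem WF.subst_eq {τ : Ty} {n : ℕ} {σ : ℕ → Ty} (h : WF n τ) (hσ : ∀ i < n, σ i = var i) :
    τ.subst σ = τ := by
  induction τ generalizing n σ with
  | var i => exact hσ i h
  | all τ ih | ex τ ih | mu τ ih =>
    simp only [Ty.subst]
    rw [ih (n := n + 1) h]
    intro i hi
    cases i with
    | zero => rfl
    | succ i => simp [up, scons, hσ i (Nat.lt_of_succ_lt_succ hi), Ty.shift, Ty.rename]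
  | _ => simp only [WF, Ty.subst] at * <;> grind

end Ty

/-! ### Closed terms are invariant under substitution -/

theorem forall_wf_map_shift {n : ℕ} {Γ : List Ty} (h : ∀ T ∈ Γ, Ty.WF n T) :
    ∀ T ∈ Γ.map Ty.shift, Ty.WF (n + 1) T := by
  intro T hT
  obtain ⟨S, hS, rfl⟩ := List.mem_map.1 hT
  exact (h S hS).shift

theorem HasType.wf {n : ℕ} {Γ : List Ty} {e : Tm} {τ : Ty} (h : HasType n Γ e τ)
    (hΓ : ∀ T ∈ Γ, Ty.WF n T) : Ty.WF n τ := by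
  induction h with
  | var h => exact hΓ _ (List.mem_of_getElem? h)
  | op o => cases o <;> trivial
  | tlam _ ih => exact ih (forall_wf_map_shift hΓ)
  | tapp _ h' ih => exact Ty.WF.inst (ih hΓ) h'
  | pack _ _ ih => exact Ty.WF.of_inst (ih hΓ)
  | unfold _ ih => exact Ty.WF.inst (ih hΓ) (ih hΓ)
  | _ => simp only [Ty.WF, List.forall_mem_cons] at * <;> grind

theorem HasType.substTy_eq {n : ℕ} {Γ : List Ty} {e : Tm} {τ : Ty} (h : HasType n Γ e τ)
    (hΓ : ∀ T ∈ Γ, Ty.WF n T) {σ : ℕ → Ty} (hσ : ∀ i < n, σ i = Ty.var i) :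
    e.substTy σ = e := by
  have hup : ∀ {n : ℕ} {σ : ℕ → Ty}, (∀ i < n, σ i = Ty.var i) →
      ∀ i < n + 1, Ty.up σ i = Ty.var i := by
    intro n σ h i hi
    cases i with
    | zero => rfl
    | succ i => simp [Ty.up, scons, h i (Nat.lt_of_succ_lt_succ hi), Ty.shift, Ty.rename]
  induction h generalizing σ with
  | var | unit | int | bool => rfl
  | inl h h' ih => rw [Tm.substTy, ih hΓ hσ, Ty.WF.subst_eq (τ := Ty.sum _ _) ⟨h.wf hΓ, h'⟩ hσ]
  | inr h h' ih => rw [Tm.substTy, ih hΓ hσ, Ty.WF.subst_eq (τ := Ty.sum _ _) ⟨h', h.wf hΓ⟩ hσ]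
  | case h _ _ ih ih₁ ih₂ =>
    have hw := h.wf hΓ
    rw [Tm.substTy, ih hΓ hσ, ih₁ (List.forall_mem_cons.2 ⟨hw.1, hΓ⟩) hσ,
      ih₂ (List.forall_mem_cons.2 ⟨hw.2, hΓ⟩) hσ]
  | lam h _ ih => rw [Tm.substTy, ih (List.forall_mem_cons.2 ⟨h, hΓ⟩) hσ, h.subst_eq hσ]
  | tlam _ ih => rw [Tm.substTy, ih (forall_wf_map_shift hΓ) (hup hσ)]
  | tapp _ h ih => rw [Tm.substTy, ih hΓ hσ, h.subst_eq hσ]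
  | @pack n _ _ _ _ h h' ih =>
    rw [Tm.substTy, ih hΓ hσ, h.subst_eq hσ,
      Ty.WF.subst_eq (τ := Ty.ex _) (n := n) (Ty.WF.of_inst (h'.wf hΓ)) hσ]
  | unpack h _ _ ih ih' =>
    rw [Tm.substTy, ih hΓ hσ,
      ih' (List.forall_mem_cons.2 ⟨h.wf hΓ, forall_wf_map_shift hΓ⟩) (hup hσ)]
  | fold _ h ih => rw [Tm.substTy, ih hΓ hσ, h.subst_eq hσ]
  | _ => simp_all [Tm.substTy]

theorem HasType.rename_eq {n : ℕ} {Γ : List Ty} {e : Tm} {τ : Ty} (h : HasType n Γ e τ)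
    {ξ : ℕ → ℕ} (hξ : ∀ i < Γ.length, ξ i = i) : e.rename ξ = e := by
  have hup : ∀ {n : ℕ} {ξ : ℕ → ℕ}, (∀ i < n, ξ i = i) → ∀ i < n + 1, upRen ξ i = i := by
    intro n ξ h i hi
    cases i with
    | zero => rfl
    | succ i => simp [upRen, scons, h i (Nat.lt_of_succ_lt_succ hi)]
  induction h generalizing ξ with
  | var h => rw [Tm.rename, hξ _ (List.getElem?_eq_some_iff.1 h).1]
  | case _ _ _ ih ih₁ ih₂ => rw [Tm.rename, ih hξ, ih₁ (hup hξ), ih₂ (hup hξ)]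
  | lam _ _ ih => rw [Tm.rename, ih (hup hξ)]
  | unpack _ _ _ ih ih' =>
    rw [Tm.rename, ih hξ, ih' (hup (by simpa using hξ))]
  | _ => simp_all [Tm.rename]

theorem HasType.subst_eq {n : ℕ} {Γ : List Ty} {e : Tm} {τ : Ty} (h : HasType n Γ e τ)
    {σ : ℕ → Tm} (hσ : ∀ i < Γ.length, σ i = Tm.var i) : e.subst σ = e := by
  have hup : ∀ {n : ℕ} {σ : ℕ → Tm}, (∀ i < n, σ i = Tm.var i) →
      ∀ i < n + 1, Tm.up σ i = Tm.var i := by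
    intro n σ h i hi
    cases i with
    | zero => rfl
    | succ i => simp [Tm.up, scons, h i (Nat.lt_of_succ_lt_succ hi), Tm.rename]
  have hupTy : ∀ {n : ℕ} {σ : ℕ → Tm}, (∀ i < n, σ i = Tm.var i) →
      ∀ i < n, Tm.upTy σ i = Tm.var i := by
    intro n σ h i hi
    simp [Tm.upTy, h i hi, Tm.shiftTy, Tm.substTy]
  induction h generalizing σ with
  | var h => exact hσ _ (List.getElem?_eq_some_iff.1 h).1
  | case _ _ _ ih ih₁ ih₂ => rw [Tm.subst, ih hσ, ih₁ (hup hσ), ih₂ (hup hσ)]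
  | lam _ _ ih => rw [Tm.subst, ih (hup hσ)]
  | tlam _ ih => rw [Tm.subst, ih (hupTy (by simpa using hσ))]
  | unpack _ _ _ ih ih' =>
    rw [Tm.subst, ih hσ, ih' (hup (hupTy (by simpa using hσ)))]
  | _ => simp_all [Tm.subst]

/-! ### Evaluation: congruence and determinism -/

/-- Composition of evaluation contexts, the first one outermost. -/
def ECtx.comp : ECtx → ECtx → ECtx
  | hole, F => F
  | opL o E e₂, F => opL o (E.comp F) e₂
  | opR o v₁ hv E, F => opR o v₁ hv (E.comp F)
  | ite E e₁ e₂, F => ite (E.comp F) e₁ e₂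
  | pairL E e₂, F => pairL (E.comp F) e₂
  | pairR v₁ hv E, F => pairR v₁ hv (E.comp F)
  | fst E, F => fst (E.comp F)
  | snd E, F => snd (E.comp F)
  | inl τ E, F => inl τ (E.comp F)
  | inr τ E, F => inr τ (E.comp F)
  | case E e₁ e₂, F => case (E.comp F) e₁ e₂
  | appL E e₂, F => appL (E.comp F) e₂
  | appR v₁ hv E, F => appR v₁ hv (E.comp F)
  | tapp E τ, F => tapp (E.comp F) τ
  | pack τ₁ E τ, F => pack τ₁ (E.comp F) τ
  | unpack E e₂, F => unpack (E.comp F) e₂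
  | fold τ E, F => fold τ (E.comp F)
  | unfold E, F => unfold (E.comp F)

theorem ECtx.fill_comp (E F : ECtx) (e : Tm) : (E.comp F).fill e = E.fill (F.fill e) := by
  induction E <;> simp_all [comp, fill]

theorem Head.step {e e' : Tm} (h : Head e e') : Step e e' := Step.fill ECtx.hole h

theorem Step.inCtx (E : ECtx) {e e' : Tm} (h : Step e e') : Step (E.fill e) (E.fill e') := by
  cases h with
  | fill F h =>
    rw [← ECtx.fill_comp, ← ECtx.fill_comp]
    exact Step.fill _ h

theorem steps_inCtx (E : ECtx) {e e' : Tm} (h : Relation.ReflTransGen Step e e') :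
    Relation.ReflTransGen Step (E.fill e) (E.fill e') :=
  h.lift E.fill fun _ _ => Step.inCtx E

theorem steps1_inCtx (E : ECtx) {e e' : Tm} (h : Relation.TransGen Step e e') :
    Relation.TransGen Step (E.fill e) (E.fill e') :=
  h.lift E.fill fun _ _ => Step.inCtx E

/-- The contractum of a term whose principal subterms do not reduce any further. On stuck terms
the result is irrelevant. -/
def contract : Tm → Option Tm
  | Tm.op o (Tm.int a) (Tm.int b) => some (o.eval a b)
  | Tm.ite (Tm.bool b) e₁ e₂ => some (if b then e₁ else e₂)
  | Tm.fst (Tm.pair v₁ _) => some v₁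
  | Tm.snd (Tm.pair _ v₂) => some v₂
  | Tm.case (Tm.inl _ v) e₁ _ => some (e₁.inst v)
  | Tm.case (Tm.inr _ v) _ e₂ => some (e₂.inst v)
  | Tm.app (Tm.lam _ e) v => some (e.inst v)
  | Tm.tapp (Tm.tlam e) τ => some (e.instTy τ)
  | Tm.unpack (Tm.pack τ₁ v _) e => some ((e.instTy τ₁).inst v)
  | Tm.unfold (Tm.fold _ v) => some v
  | _ => none

/-- The reduct of a term as a partial function; it contains the relation `Step`. -/
def next : Tm → Option Tm
  | Tm.op o e₁ e₂ => ((next e₁).map (Tm.op o · e₂)).or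
      (((next e₂).map (Tm.op o e₁ ·)).or (contract (Tm.op o e₁ e₂)))
  | Tm.ite e e₁ e₂ => ((next e).map (Tm.ite · e₁ e₂)).or (contract (Tm.ite e e₁ e₂))
  | Tm.pair e₁ e₂ => ((next e₁).map (Tm.pair · e₂)).or ((next e₂).map (Tm.pair e₁ ·))
  | Tm.fst e => ((next e).map Tm.fst).or (contract (Tm.fst e))
  | Tm.snd e => ((next e).map Tm.snd).or (contract (Tm.snd e))
  | Tm.inl τ e => (next e).map (Tm.inl τ)
  | Tm.inr τ e => (next e).map (Tm.inr τ)
  | Tm.case e e₁ e₂ => ((next e).map (Tm.case · e₁ e₂)).or (contract (Tm.case e e₁ e₂))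
  | Tm.app e₁ e₂ => ((next e₁).map (Tm.app · e₂)).or
      (((next e₂).map (Tm.app e₁ ·)).or (contract (Tm.app e₁ e₂)))
  | Tm.tapp e τ => ((next e).map (Tm.tapp · τ)).or (contract (Tm.tapp e τ))
  | Tm.pack τ₁ e τ => (next e).map (Tm.pack τ₁ · τ)
  | Tm.unpack e e₂ => ((next e).map (Tm.unpack · e₂)).or (contract (Tm.unpack e e₂))
  | Tm.fold τ e => (next e).map (Tm.fold τ)
  | Tm.unfold e => ((next e).map Tm.unfold).or (contract (Tm.unfold e))
  | _ => none

theorem Value.next_eq {v : Tm} (h : Value v) : next v = none := by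
  induction h <;> simp_all [next]

theorem Head.next_eq {e e' : Tm} (h : Head e e') : next e = some e' := by
  cases h <;> simp [next, contract, Value.next_eq, *]

theorem Step.next_eq {e e' : Tm} (h : Step e e') : next e = some e' := by
  cases h with
  | fill E h =>
    have := h.next_eq
    induction E <;> simp_all [next, ECtx.fill, Value.next_eq]

theorem Step.deterministic {e e₁ e₂ : Tm} (h₁ : Step e e₁) (h₂ : Step e e₂) : e₁ = e₂ :=
  Option.some.inj (h₁.next_eq.symm.trans h₂.next_eq)

theorem Value.not_step {v e : Tm} (h : Value v) : ¬ Step v e := fun hs => by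
  have := hs.next_eq
  simp [h.next_eq] at this

/-- As reduction is deterministic, a terminating term has no infinite reduction sequence. -/
theorem Terminates.acc {e : Tm} (h : Terminates e) : Acc (fun a b => Step b a) e := by
  obtain ⟨v, hs, hv⟩ := h
  induction hs using Relation.ReflTransGen.head_induction_on with
  | refl => exact ⟨_, fun _ h => (hv.not_step h).elim⟩
  | head h _ ih => exact ⟨_, fun _ h' => h.deterministic h' ▸ ih⟩

/-- A simulation in which both sides take at least one step, or are values, preserves termination:
by determinism the evaluation of the left-hand side is well-founded. -/
theorem Terminates.of_simulation {R : Tm → Tm → Prop}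
    (hR : ∀ e₁ e₂, R e₁ e₂ → (Value e₁ ∧ Value e₂) ∨ ∃ e₁' e₂',
      Relation.TransGen Step e₁ e₁' ∧ Relation.TransGen Step e₂ e₂' ∧ R e₁' e₂')
    {e₁ e₂ : Tm} (h : R e₁ e₂) (ht : Terminates e₁) : Terminates e₂ := by
  have hacc := ht.acc.transGen
  clear ht
  induction hacc generalizing e₂ with
  | intro e₁ _ ih =>
    rcases hR _ _ h with ⟨_, hv⟩ | ⟨e₁', e₂', h₁, h₂, h'⟩
    · exact ⟨e₂, .refl, hv⟩
    · obtain ⟨v, hs, hv⟩ := ih e₁' (Relation.transGen_swap.1 h₁) h'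
      exact ⟨v, h₂.to_reflTransGen.trans hs, hv⟩

/-! ### Typing of the flag objects -/

theorem fldTy_subst (τ : Ty) (σ : ℕ → Ty) : (fldTy τ).subst σ = fldTy (τ.subst σ) := by
  rw [fldTy, Ty.subst, Ty.subst, Ty.shift_subst_up]
  rfl

theorem flagTy_inst (τ : Ty) : (fldTy (Ty.var 0)).inst τ = fldTy τ := by
  rw [Ty.inst, fldTy_subst]
  rfl

/-- The type of the unfolding of a flag object. -/
theorem fldTy_unfold (α : Ty) :
    (Ty.prod α.shift (Ty.prod (Ty.arr (Ty.var 0) (Ty.var 0)) (Ty.arr (Ty.var 0) Ty.bool))).inst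
      (fldTy α) =
    Ty.prod α (Ty.prod (Ty.arr (fldTy α) (fldTy α)) (Ty.arr (fldTy α) Ty.bool)) := by
  rw [Ty.inst, Ty.subst, ← Ty.inst, Ty.shift_inst]
  rfl

theorem fldTy_wf {α : Ty} {n : ℕ} (h : Ty.WF n α) : Ty.WF n (fldTy α) :=
  ⟨h.shift, ⟨Nat.succ_pos n, Nat.succ_pos n⟩, Nat.succ_pos n, trivial⟩

theorem unfold_hasType {n : ℕ} {Γ : List Ty} {e : Tm} {α : Ty} (h : HasType n Γ e (fldTy α)) :
    HasType n Γ (Tm.unfold e)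
      (Ty.prod α (Ty.prod (Ty.arr (fldTy α) (fldTy α)) (Ty.arr (fldTy α) Ty.bool))) := by
  rw [← fldTy_unfold]
  exact HasType.unfold h

theorem fold_hasType {n : ℕ} {Γ : List Ty} {e : Tm} {α : Ty} (hα : Ty.WF n α)
    (h : HasType n Γ e
      (Ty.prod α (Ty.prod (Ty.arr (fldTy α) (fldTy α)) (Ty.arr (fldTy α) Ty.bool)))) :
    HasType n Γ (Tm.fold (fldTy α) e) (fldTy α) := by
  rw [← fldTy_unfold] at h
  exact HasType.fold h (fldTy_wf hα)

theorem HasType.weaken {n : ℕ} {Γ : List Ty} {e : Tm} {τ : Ty} (Δ : List Ty)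
    (h : HasType n Γ e τ) : HasType n (Γ ++ Δ) e τ := by
  induction h generalizing Δ with
  | var h => exact .var (by
      rw [List.getElem?_append_left (List.getElem?_eq_some_iff.1 h).1, h])
  | unit => exact .unit
  | int z => exact .int z
  | bool b => exact .bool b
  | op o _ _ ih₁ ih₂ => exact .op o (ih₁ Δ) (ih₂ Δ)
  | ite _ _ _ ih ih₁ ih₂ => exact .ite (ih Δ) (ih₁ Δ) (ih₂ Δ)
  | pair _ _ ih₁ ih₂ => exact .pair (ih₁ Δ) (ih₂ Δ)
  | fst _ ih => exact .fst (ih Δ)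
  | snd _ ih => exact .snd (ih Δ)
  | inl _ h ih => exact .inl (ih Δ) h
  | inr _ h ih => exact .inr (ih Δ) h
  | case _ _ _ ih ih₁ ih₂ => exact .case (ih Δ) (ih₁ Δ) (ih₂ Δ)
  | lam h _ ih => exact .lam h (ih Δ)
  | app _ _ ih₁ ih₂ => exact .app (ih₁ Δ) (ih₂ Δ)
  | tlam _ ih => exact .tlam (by rw [List.map_append]; exact ih _)
  | tapp _ h ih => exact .tapp (ih Δ) h
  | pack h _ ih => exact .pack h (ih Δ)
  | unpack _ h _ ih₁ ih₂ => exact .unpack (ih₁ Δ) h (by rw [List.map_append]; exact ih₂ _)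
  | fold _ h ih => exact .fold (ih Δ) h
  | unfold _ ih => exact .unfold (ih Δ)

theorem bflag_hasType {neg : Tm} (hn : HasType 0 [] neg (Ty.arr Ty.bool Ty.bool)) :
    HasType 0 [] (bflag neg) flagTy := by
  have hx : HasType 0 [fldTy Ty.bool] (Tm.var 0) (fldTy Ty.bool) := .var rfl
  refine .pack trivial ?_
  rw [flagTy_inst]
  refine fold_hasType trivial (.pair (.bool _) (.pair ?_ ?_))
  · exact .lam (fldTy_wf trivial) (fold_hasType trivial (.pair
      (.app (hn.weaken _) (.fst (unfold_hasType hx))) (.snd (unfold_hasType hx))))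
  · exact .lam (fldTy_wf trivial) (.fst (unfold_hasType hx))

theorem iflag_hasType {ev : Tm} (he : HasType 0 [] ev (Ty.arr Ty.int Ty.bool)) :
    HasType 0 [] (iflag ev) flagTy := by
  have hx : HasType 0 [fldTy Ty.int] (Tm.var 0) (fldTy Ty.int) := .var rfl
  refine .pack trivial ?_
  rw [flagTy_inst]
  refine fold_hasType trivial (.pair (.int _) (.pair ?_ ?_))
  · exact .lam (fldTy_wf trivial) (fold_hasType trivial (.pair
      (.op .add (.int 1) (.fst (unfold_hasType hx))) (.snd (unfold_hasType hx))))
  · exact .lam (fldTy_wf trivial) (.app (he.weaken _) (.fst (unfold_hasType hx)))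

/-! ### The relation between the two implementations -/

/-- Relational typing of pairs of terms, with a distinguished type variable `k` that stands for the
hidden state type of the flag objects: at type `var k` the boolean `Even z` is related to the
integer `z`, and the methods of the two objects are related at their types over `var k`. The
remaining rules are the typing rules, read for two terms of the same shape. Type annotations and
type arguments in terms are left unconstrained, as they do not influence evaluation. Result types
that involve a substitution are given by an equation, so that inversion at a given type works. -/
inductive FlagRel (neg ev : Tm) : ℕ → List Ty → Tm → Tm → Ty → Prop
  | state {k : ℕ} {Γ : List Ty} (z : ℤ) :
      FlagRel neg ev k Γ (Tm.bool (decide (Even z))) (Tm.int z) (Ty.var k)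
  | flip {k : ℕ} {Γ : List Ty} :
      FlagRel neg ev k Γ (bflip neg) iflip (Ty.arr (fldTy (Ty.var k)) (fldTy (Ty.var k)))
  | ret {k : ℕ} {Γ : List Ty} :
      FlagRel neg ev k Γ bret (iret ev) (Ty.arr (fldTy (Ty.var k)) Ty.bool)
  | var {k : ℕ} {Γ : List Ty} {i : ℕ} {τ : Ty} : Γ[i]? = some τ →
      FlagRel neg ev k Γ (Tm.var i) (Tm.var i) τ
  | unit {k : ℕ} {Γ : List Ty} : FlagRel neg ev k Γ Tm.unit Tm.unit Ty.unit
  | int {k : ℕ} {Γ : List Ty} (z : ℤ) : FlagRel neg ev k Γ (Tm.int z) (Tm.int z) Ty.int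
  | bool {k : ℕ} {Γ : List Ty} (b : Bool) : FlagRel neg ev k Γ (Tm.bool b) (Tm.bool b) Ty.bool
  | op {k : ℕ} {Γ : List Ty} {e₁ e₂ f₁ f₂ : Tm} {τ : Ty} (o : PrimOp) :
      FlagRel neg ev k Γ e₁ f₁ Ty.int → FlagRel neg ev k Γ e₂ f₂ Ty.int → τ = o.resTy →
      FlagRel neg ev k Γ (Tm.op o e₁ e₂) (Tm.op o f₁ f₂) τ
  | ite {k : ℕ} {Γ : List Ty} {e e₁ e₂ f f₁ f₂ : Tm} {τ : Ty} :
      FlagRel neg ev k Γ e f Ty.bool → FlagRel neg ev k Γ e₁ f₁ τ → FlagRel neg ev k Γ e₂ f₂ τ →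
      FlagRel neg ev k Γ (Tm.ite e e₁ e₂) (Tm.ite f f₁ f₂) τ
  | pair {k : ℕ} {Γ : List Ty} {e₁ e₂ f₁ f₂ : Tm} {τ₁ τ₂ : Ty} :
      FlagRel neg ev k Γ e₁ f₁ τ₁ → FlagRel neg ev k Γ e₂ f₂ τ₂ →
      FlagRel neg ev k Γ (Tm.pair e₁ e₂) (Tm.pair f₁ f₂) (Ty.prod τ₁ τ₂)
  | fst {k : ℕ} {Γ : List Ty} {e f : Tm} {τ₁ τ₂ : Ty} :
      FlagRel neg ev k Γ e f (Ty.prod τ₁ τ₂) → FlagRel neg ev k Γ (Tm.fst e) (Tm.fst f) τ₁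
  | snd {k : ℕ} {Γ : List Ty} {e f : Tm} {τ₁ τ₂ : Ty} :
      FlagRel neg ev k Γ e f (Ty.prod τ₁ τ₂) → FlagRel neg ev k Γ (Tm.snd e) (Tm.snd f) τ₂
  | inl {k : ℕ} {Γ : List Ty} {e f : Tm} {τ₁ τ₂ : Ty} (a b : Ty) :
      FlagRel neg ev k Γ e f τ₁ → FlagRel neg ev k Γ (Tm.inl a e) (Tm.inl b f) (Ty.sum τ₁ τ₂)
  | inr {k : ℕ} {Γ : List Ty} {e f : Tm} {τ₁ τ₂ : Ty} (a b : Ty) :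
      FlagRel neg ev k Γ e f τ₂ → FlagRel neg ev k Γ (Tm.inr a e) (Tm.inr b f) (Ty.sum τ₁ τ₂)
  | case {k : ℕ} {Γ : List Ty} {e e₁ e₂ f f₁ f₂ : Tm} {τ₁ τ₂ τ : Ty} :
      FlagRel neg ev k Γ e f (Ty.sum τ₁ τ₂) → FlagRel neg ev k (τ₁ :: Γ) e₁ f₁ τ →
      FlagRel neg ev k (τ₂ :: Γ) e₂ f₂ τ →
      FlagRel neg ev k Γ (Tm.case e e₁ e₂) (Tm.case f f₁ f₂) τ
  | lam {k : ℕ} {Γ : List Ty} {e f : Tm} {τ₁ τ₂ : Ty} (a b : Ty) :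
      FlagRel neg ev k (τ₁ :: Γ) e f τ₂ →
      FlagRel neg ev k Γ (Tm.lam a e) (Tm.lam b f) (Ty.arr τ₁ τ₂)
  | app {k : ℕ} {Γ : List Ty} {e₁ e₂ f₁ f₂ : Tm} {τ₂ τ : Ty} :
      FlagRel neg ev k Γ e₁ f₁ (Ty.arr τ₂ τ) → FlagRel neg ev k Γ e₂ f₂ τ₂ →
      FlagRel neg ev k Γ (Tm.app e₁ e₂) (Tm.app f₁ f₂) τ
  | tlam {k : ℕ} {Γ : List Ty} {e f : Tm} {τ : Ty} :
      FlagRel neg ev (k + 1) (Γ.map Ty.shift) e f τ →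
      FlagRel neg ev k Γ (Tm.tlam e) (Tm.tlam f) (Ty.all τ)
  | tapp {k : ℕ} {Γ : List Ty} {e f : Tm} {τ τ' : Ty} (τ₁ a b : Ty) :
      FlagRel neg ev k Γ e f (Ty.all τ) → τ' = τ.inst τ₁ →
      FlagRel neg ev k Γ (Tm.tapp e a) (Tm.tapp f b) τ'
  | pack {k : ℕ} {Γ : List Ty} {e f : Tm} {τ : Ty} (τ₁ a b a' b' : Ty) :
      FlagRel neg ev k Γ e f (τ.inst τ₁) →
      FlagRel neg ev k Γ (Tm.pack a e a') (Tm.pack b f b') (Ty.ex τ)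
  | unpack {k : ℕ} {Γ : List Ty} {e₁ e₂ f₁ f₂ : Tm} {τ₁ τ : Ty} :
      FlagRel neg ev k Γ e₁ f₁ (Ty.ex τ₁) →
      FlagRel neg ev (k + 1) (τ₁ :: Γ.map Ty.shift) e₂ f₂ τ.shift →
      FlagRel neg ev k Γ (Tm.unpack e₁ e₂) (Tm.unpack f₁ f₂) τ
  | fold {k : ℕ} {Γ : List Ty} {e f : Tm} {τ : Ty} (a b : Ty) :
      FlagRel neg ev k Γ e f (τ.inst (Ty.mu τ)) →
      FlagRel neg ev k Γ (Tm.fold a e) (Tm.fold b f) (Ty.mu τ)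
  | unfold {k : ℕ} {Γ : List Ty} {e f : Tm} {τ τ' : Ty} :
      FlagRel neg ev k Γ e f (Ty.mu τ) → τ' = τ.inst (Ty.mu τ) →
      FlagRel neg ev k Γ (Tm.unfold e) (Tm.unfold f) τ'

/-- Substitution of types. The substitutions in the terms need not agree with the one in the
types, as the relation ignores annotations; the distinguished variable has to go to a variable. -/
theorem FlagRel.substTy {neg ev : Tm} (hn : HasType 0 [] neg (Ty.arr Ty.bool Ty.bool))
    (he : HasType 0 [] ev (Ty.arr Ty.int Ty.bool)) {k : ℕ} {Γ : List Ty} {e f : Tm} {τ : Ty}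
    (h : FlagRel neg ev k Γ e f τ) (σ₁ σ₂ : ℕ → Ty) {σ : ℕ → Ty} {k' : ℕ}
    (hσ : σ k = Ty.var k') :
    FlagRel neg ev k' (Γ.map (Ty.subst σ)) (e.substTy σ₁) (f.substTy σ₂) (τ.subst σ) := by
  have hup : ∀ {k k' : ℕ} {σ : ℕ → Ty}, σ k = Ty.var k' → Ty.up σ (k + 1) = Ty.var (k' + 1) := by
    intro k k' σ h
    simp [Ty.up, scons, h, Ty.shift, Ty.rename]
  have hmap : ∀ (Γ : List Ty) (σ : ℕ → Ty),
      (Γ.map Ty.shift).map (Ty.subst (Ty.up σ)) = (Γ.map (Ty.subst σ)).map Ty.shift := by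
    intro Γ σ
    simp [Ty.shift_subst_up]
  induction h generalizing σ₁ σ₂ σ k' with
  | state z => rw [Ty.subst, hσ]; exact state z
  | flip =>
    rw [Ty.subst, fldTy_subst, Ty.subst, hσ, bflip, Tm.substTy, Tm.substTy, Tm.substTy,
      Tm.substTy, Tm.substTy, hn.substTy_eq (by simp) (by simp)]
    exact flip
  | ret =>
    rw [iret, Ty.subst, fldTy_subst, Ty.subst, hσ, Tm.substTy, Tm.substTy,
      he.substTy_eq (by simp) (by simp)]
    exact ret
  | var h => exact var (by simp [h])
  | unit => exact unit
  | int z => exact int z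
  | bool b => exact bool b
  | op o _ _ h ih₁ ih₂ =>
    exact op o (ih₁ _ _ hσ) (ih₂ _ _ hσ) (by subst h; cases o <;> rfl)
  | ite _ _ _ ih ih₁ ih₂ => exact ite (ih _ _ hσ) (ih₁ _ _ hσ) (ih₂ _ _ hσ)
  | pair _ _ ih₁ ih₂ => exact pair (ih₁ _ _ hσ) (ih₂ _ _ hσ)
  | fst _ ih => exact fst (ih _ _ hσ)
  | snd _ ih => exact snd (ih _ _ hσ)
  | inl a b _ ih => exact inl _ _ (ih _ _ hσ)
  | inr a b _ ih => exact inr _ _ (ih _ _ hσ)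
  | case _ _ _ ih ih₁ ih₂ => exact case (ih _ _ hσ) (ih₁ _ _ hσ) (ih₂ _ _ hσ)
  | lam a b _ ih => exact lam _ _ (ih _ _ hσ)
  | app _ _ ih₁ ih₂ => exact app (ih₁ _ _ hσ) (ih₂ _ _ hσ)
  | tlam _ ih => exact tlam (hmap _ _ ▸ ih _ _ (hup hσ))
  | tapp τ₁ a b _ h ih => exact tapp _ _ _ (ih _ _ hσ) (by rw [h, Ty.inst_subst])
  | pack τ₁ a b a' b' _ ih => exact pack _ _ _ _ _ (Ty.inst_subst _ _ _ ▸ ih _ _ hσ)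
  | unpack _ _ ih₁ ih₂ =>
    refine unpack (ih₁ _ _ hσ) ?_
    have := ih₂ (Ty.up σ₁) (Ty.up σ₂) (hup hσ)
    rwa [List.map_cons, hmap, Ty.shift_subst_up] at this
  | fold a b _ ih =>
    have := ih σ₁ σ₂ hσ
    rw [Ty.inst_subst] at this
    exact fold _ _ this
  | unfold _ h ih => exact unfold (ih _ _ hσ) (by rw [h, Ty.inst_subst]; rfl)

theorem FlagRel.shiftTy {neg ev : Tm} (hn : HasType 0 [] neg (Ty.arr Ty.bool Ty.bool))
    (he : HasType 0 [] ev (Ty.arr Ty.int Ty.bool)) {k : ℕ} {Γ : List Ty} {e f : Tm} {τ : Ty}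
    (h : FlagRel neg ev k Γ e f τ) :
    FlagRel neg ev (k + 1) (Γ.map Ty.shift) e.shiftTy f.shiftTy τ.shift := by
  have hs : Ty.shift = Ty.subst fun i => Ty.var (i + 1) :=
    funext fun τ => Ty.rename_eq_subst τ Nat.succ
  rw [hs]
  exact h.substTy hn he _ _ rfl

theorem FlagRel.instTy {neg ev : Tm} (hn : HasType 0 [] neg (Ty.arr Ty.bool Ty.bool))
    (he : HasType 0 [] ev (Ty.arr Ty.int Ty.bool)) {k : ℕ} {Γ : List Ty} {e f : Tm} {τ : Ty}
    (h : FlagRel neg ev (k + 1) Γ e f τ) (τ₁ a b : Ty) :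
    FlagRel neg ev k (Γ.map (Ty.inst · τ₁)) (e.instTy a) (f.instTy b) (τ.inst τ₁) :=
  h.substTy hn he _ _ rfl

theorem getElem?_upRen {Γ Δ : List Ty} {ξ : ℕ → ℕ} (S : Ty)
    (hξ : ∀ i T, Γ[i]? = some T → Δ[ξ i]? = some T) :
    ∀ i T, (S :: Γ)[i]? = some T → (S :: Δ)[upRen ξ i]? = some T := by
  intro i T h
  cases i with
  | zero => exact h
  | succ i => exact hξ i T h

theorem FlagRel.rename {neg ev : Tm} (hn : HasType 0 [] neg (Ty.arr Ty.bool Ty.bool))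
    (he : HasType 0 [] ev (Ty.arr Ty.int Ty.bool)) {k : ℕ} {Γ Δ : List Ty} {e f : Tm} {τ : Ty}
    (h : FlagRel neg ev k Γ e f τ) {ξ : ℕ → ℕ} (hξ : ∀ i T, Γ[i]? = some T → Δ[ξ i]? = some T) :
    FlagRel neg ev k Δ (e.rename ξ) (f.rename ξ) τ := by
  have hmap : ∀ {Γ Δ : List Ty} {ξ : ℕ → ℕ}, (∀ i T, Γ[i]? = some T → Δ[ξ i]? = some T) →
      ∀ i T, (Γ.map Ty.shift)[i]? = some T → (Δ.map Ty.shift)[ξ i]? = some T := by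
    intro Γ Δ ξ hξ i T h
    rw [List.getElem?_map, Option.map_eq_some_iff] at h ⊢
    obtain ⟨S, hS, hT⟩ := h
    exact ⟨S, hξ i S hS, hT⟩
  induction h generalizing Δ ξ with
  | state z => exact state z
  | flip =>
    rw [bflip, Tm.rename, Tm.rename, Tm.rename, Tm.rename, Tm.rename, hn.rename_eq (by simp)]
    exact flip
  | ret =>
    rw [iret, Tm.rename, Tm.rename, he.rename_eq (by simp)]
    exact ret
  | var h => exact var (hξ _ _ h)
  | unit => exact unit
  | int z => exact int z
  | bool b => exact bool b
  | op o _ _ h ih₁ ih₂ => exact op o (ih₁ hξ) (ih₂ hξ) h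
  | ite _ _ _ ih ih₁ ih₂ => exact ite (ih hξ) (ih₁ hξ) (ih₂ hξ)
  | pair _ _ ih₁ ih₂ => exact pair (ih₁ hξ) (ih₂ hξ)
  | fst _ ih => exact fst (ih hξ)
  | snd _ ih => exact snd (ih hξ)
  | inl a b _ ih => exact inl _ _ (ih hξ)
  | inr a b _ ih => exact inr _ _ (ih hξ)
  | case _ _ _ ih ih₁ ih₂ =>
    exact case (ih hξ) (ih₁ (getElem?_upRen _ hξ)) (ih₂ (getElem?_upRen _ hξ))
  | lam a b _ ih => exact lam _ _ (ih (getElem?_upRen _ hξ))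
  | app _ _ ih₁ ih₂ => exact app (ih₁ hξ) (ih₂ hξ)
  | tlam _ ih => exact tlam (ih (hmap hξ))
  | tapp τ₁ a b _ h ih => exact tapp _ _ _ (ih hξ) h
  | pack τ₁ a b a' b' _ ih => exact pack _ _ _ _ _ (ih hξ)
  | unpack _ _ ih₁ ih₂ => exact unpack (ih₁ hξ) (ih₂ (getElem?_upRen _ (hmap hξ)))
  | fold a b _ ih => exact fold _ _ (ih hξ)
  | unfold _ h ih => exact unfold (ih hξ) h

theorem FlagRel.subst {neg ev : Tm} (hn : HasType 0 [] neg (Ty.arr Ty.bool Ty.bool))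
    (he : HasType 0 [] ev (Ty.arr Ty.int Ty.bool)) {k : ℕ} {Γ Δ : List Ty} {e f : Tm} {τ : Ty}
    (h : FlagRel neg ev k Γ e f τ) {σ₁ σ₂ : ℕ → Tm}
    (hσ : ∀ i T, Γ[i]? = some T → FlagRel neg ev k Δ (σ₁ i) (σ₂ i) T) :
    FlagRel neg ev k Δ (e.subst σ₁) (f.subst σ₂) τ := by
  have hup : ∀ {k : ℕ} {Γ Δ : List Ty} {σ₁ σ₂ : ℕ → Tm} (S : Ty),
      (∀ i T, Γ[i]? = some T → FlagRel neg ev k Δ (σ₁ i) (σ₂ i) T) →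
      ∀ i T, (S :: Γ)[i]? = some T → FlagRel neg ev k (S :: Δ) (Tm.up σ₁ i) (Tm.up σ₂ i) T := by
    intro k Γ Δ σ₁ σ₂ S hσ i T h
    cases i with
    | zero => exact var h
    | succ i => exact (hσ i T h).rename hn he fun _ _ h => h
  have hmap : ∀ {k : ℕ} {Γ Δ : List Ty} {σ₁ σ₂ : ℕ → Tm},
      (∀ i T, Γ[i]? = some T → FlagRel neg ev k Δ (σ₁ i) (σ₂ i) T) →
      ∀ i T, (Γ.map Ty.shift)[i]? = some T →
        FlagRel neg ev (k + 1) (Δ.map Ty.shift) (Tm.upTy σ₁ i) (Tm.upTy σ₂ i) T := by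
    intro k Γ Δ σ₁ σ₂ hσ i T h
    rw [List.getElem?_map, Option.map_eq_some_iff] at h
    obtain ⟨S, hS, rfl⟩ := h
    exact (hσ i S hS).shiftTy hn he
  induction h generalizing Δ σ₁ σ₂ with
  | state z => exact state z
  | flip =>
    rw [bflip, Tm.subst, Tm.subst, Tm.subst, Tm.subst, Tm.subst, hn.subst_eq (by simp)]
    exact flip
  | ret =>
    rw [iret, Tm.subst, Tm.subst, he.subst_eq (by simp)]
    exact ret
  | var h => exact hσ _ _ h
  | unit => exact unit
  | int z => exact int z
  | bool b => exact bool b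
  | op o _ _ h ih₁ ih₂ => exact op o (ih₁ hσ) (ih₂ hσ) h
  | ite _ _ _ ih ih₁ ih₂ => exact ite (ih hσ) (ih₁ hσ) (ih₂ hσ)
  | pair _ _ ih₁ ih₂ => exact pair (ih₁ hσ) (ih₂ hσ)
  | fst _ ih => exact fst (ih hσ)
  | snd _ ih => exact snd (ih hσ)
  | inl a b _ ih => exact inl _ _ (ih hσ)
  | inr a b _ ih => exact inr _ _ (ih hσ)
  | case _ _ _ ih ih₁ ih₂ => exact case (ih hσ) (ih₁ (hup _ hσ)) (ih₂ (hup _ hσ))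
  | lam a b _ ih => exact lam _ _ (ih (hup _ hσ))
  | app _ _ ih₁ ih₂ => exact app (ih₁ hσ) (ih₂ hσ)
  | tlam _ ih => exact tlam (ih (hmap hσ))
  | tapp τ₁ a b _ h ih => exact tapp _ _ _ (ih hσ) h
  | pack τ₁ a b a' b' _ ih => exact pack _ _ _ _ _ (ih hσ)
  | unpack _ _ ih₁ ih₂ => exact unpack (ih₁ hσ) (ih₂ (hup _ (hmap hσ)))
  | fold a b _ ih => exact fold _ _ (ih hσ)
  | unfold _ h ih => exact unfold (ih hσ) h

theorem FlagRel.inst {neg ev : Tm} (hn : HasType 0 [] neg (Ty.arr Ty.bool Ty.bool))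
    (he : HasType 0 [] ev (Ty.arr Ty.int Ty.bool)) {k : ℕ} {Γ : List Ty} {e f v w : Tm} {S τ : Ty}
    (h : FlagRel neg ev k (S :: Γ) e f τ) (hv : FlagRel neg ev k Γ v w S) :
    FlagRel neg ev k Γ (e.inst v) (f.inst w) τ := by
  refine h.subst hn he fun i T hi => ?_
  cases i with
  | zero =>
    obtain rfl : S = T := Option.some.inj hi
    exact hv
  | succ i => exact var hi

/-! ### Reflexivity and compatibility with program contexts -/

/-- A well-typed term is related to itself. The number `n` of type variables in scope plays no
role, and any variable `k` may be the distinguished one. -/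
theorem HasType.flagRel {neg ev : Tm} {n : ℕ} {Γ : List Ty} {e : Tm} {τ : Ty}
    (h : HasType n Γ e τ) (k : ℕ) : FlagRel neg ev k Γ e e τ := by
  induction h generalizing k with
  | var h => exact .var h
  | unit => exact .unit
  | int z => exact .int z
  | bool b => exact .bool b
  | op o _ _ ih₁ ih₂ => exact .op o (ih₁ k) (ih₂ k) rfl
  | ite _ _ _ ih ih₁ ih₂ => exact .ite (ih k) (ih₁ k) (ih₂ k)
  | pair _ _ ih₁ ih₂ => exact .pair (ih₁ k) (ih₂ k)
  | fst _ ih => exact .fst (ih k)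
  | snd _ ih => exact .snd (ih k)
  | inl _ _ ih => exact .inl _ _ (ih k)
  | inr _ _ ih => exact .inr _ _ (ih k)
  | case _ _ _ ih ih₁ ih₂ => exact .case (ih k) (ih₁ k) (ih₂ k)
  | lam _ _ ih => exact .lam _ _ (ih k)
  | app _ _ ih₁ ih₂ => exact .app (ih₁ k) (ih₂ k)
  | tlam _ ih => exact .tlam (ih _)
  | tapp _ _ ih => exact .tapp _ _ _ (ih k) rfl
  | pack _ _ ih => exact .pack _ _ _ _ _ (ih k)
  | unpack _ _ _ ih₁ ih₂ => exact .unpack (ih₁ k) (ih₂ _)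
  | fold _ _ ih => exact .fold _ _ (ih k)
  | unfold _ ih => exact .unfold (ih k) rfl

/-- The two flag objects are related: the hidden state type is taken to be the distinguished
variable. -/
theorem flagRel_flags (neg ev : Tm) (k : ℕ) (Γ : List Ty) :
    FlagRel neg ev k Γ (bflag neg) (iflag ev) flagTy := by
  refine .pack (Ty.var k) _ _ _ _ ?_
  rw [flagTy_inst]
  refine .fold _ _ ?_
  have h := fldTy_unfold (Ty.var k)
  simp only [fldTy] at h ⊢
  rw [h]
  exact .pair (by simpa using FlagRel.state (neg := neg) (ev := ev) (k := k) (Γ := Γ) 0)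
    (.pair .flip .ret)

/-- Plugging the two flag objects into a well-typed program context gives related programs. -/
theorem CtxHasType.flagRel {neg ev : Tm} {n : ℕ} {Γ : List Ty} {C : Ctx} {τ : Ty}
    (h : CtxHasType flagTy C n Γ τ) (k : ℕ) :
    FlagRel neg ev k Γ (C.plug (bflag neg)) (C.plug (iflag ev)) τ := by
  induction h generalizing k with
  | hole => exact flagRel_flags neg ev k _
  | opL o _ h ih => exact .op o (ih k) (h.flagRel k) rfl
  | opR o h _ ih => exact .op o (h.flagRel k) (ih k) rfl
  | iteC _ h₁ h₂ ih => exact .ite (ih k) (h₁.flagRel k) (h₂.flagRel k)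
  | iteL h _ h₂ ih => exact .ite (h.flagRel k) (ih k) (h₂.flagRel k)
  | iteR h h₁ _ ih => exact .ite (h.flagRel k) (h₁.flagRel k) (ih k)
  | pairL _ h ih => exact .pair (ih k) (h.flagRel k)
  | pairR h _ ih => exact .pair (h.flagRel k) (ih k)
  | fst _ ih => exact .fst (ih k)
  | snd _ ih => exact .snd (ih k)
  | inl _ _ ih => exact .inl _ _ (ih k)
  | inr _ _ ih => exact .inr _ _ (ih k)
  | caseC _ h₁ h₂ ih => exact .case (ih k) (h₁.flagRel k) (h₂.flagRel k)
  | caseL h _ h₂ ih => exact .case (h.flagRel k) (ih k) (h₂.flagRel k)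
  | caseR h h₁ _ ih => exact .case (h.flagRel k) (h₁.flagRel k) (ih k)
  | lam _ _ ih => exact .lam _ _ (ih k)
  | appL _ h ih => exact .app (ih k) (h.flagRel k)
  | appR h _ ih => exact .app (h.flagRel k) (ih k)
  | tlam _ ih => exact .tlam (ih _)
  | tapp _ _ ih => exact .tapp _ _ _ (ih k) rfl
  | pack _ _ ih => exact .pack _ _ _ _ _ (ih k)
  | unpackL _ _ h ih => exact .unpack (ih k) (h.flagRel _)
  | unpackR h _ _ ih => exact .unpack (h.flagRel k) (ih _)
  | fold _ _ ih => exact .fold _ _ (ih k)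
  | unfold _ ih => exact .unfold (ih k) rfl

/-! ### Canonical forms -/

section CanonicalForms

variable {neg ev : Tm} {k : ℕ} {v w : Tm}

theorem FlagRel.var_inv (h : FlagRel neg ev k [] v w (Ty.var k)) (hv : Value v) :
    ∃ z : ℤ, v = Tm.bool (decide (Even z)) ∧ w = Tm.int z := by
  cases h with
  | state z => exact ⟨z, rfl, rfl⟩
  | var h => simp at h
  | _ => cases hv

theorem FlagRel.int_inv (h : FlagRel neg ev k [] v w Ty.int) (hv : Value v) :
    ∃ z : ℤ, v = Tm.int z ∧ w = Tm.int z := by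
  cases h with
  | int z => exact ⟨z, rfl, rfl⟩
  | var h => simp at h
  | _ => cases hv

theorem FlagRel.bool_inv (h : FlagRel neg ev k [] v w Ty.bool) (hv : Value v) :
    ∃ b : Bool, v = Tm.bool b ∧ w = Tm.bool b := by
  cases h with
  | bool b => exact ⟨b, rfl, rfl⟩
  | var h => simp at h
  | _ => cases hv

theorem FlagRel.prod_inv {τ₁ τ₂ : Ty} (h : FlagRel neg ev k [] v w (Ty.prod τ₁ τ₂))
    (hv : Value v) (hw : Value w) : ∃ v₁ v₂ w₁ w₂, v = Tm.pair v₁ v₂ ∧ w = Tm.pair w₁ w₂ ∧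
      (Value v₁ ∧ Value v₂ ∧ Value w₁ ∧ Value w₂) ∧
      FlagRel neg ev k [] v₁ w₁ τ₁ ∧ FlagRel neg ev k [] v₂ w₂ τ₂ := by
  cases h with
  | pair h₁ h₂ =>
    cases hv with | pair hv₁ hv₂ =>
    cases hw with | pair hw₁ hw₂ =>
    exact ⟨_, _, _, _, rfl, rfl, ⟨hv₁, hv₂, hw₁, hw₂⟩, h₁, h₂⟩
  | var h => simp at h
  | _ => cases hv

theorem FlagRel.sum_inv {τ₁ τ₂ : Ty} (h : FlagRel neg ev k [] v w (Ty.sum τ₁ τ₂))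
    (hv : Value v) (hw : Value w) : ∃ a b v' w', (Value v' ∧ Value w') ∧
      ((v = Tm.inl a v' ∧ w = Tm.inl b w' ∧ FlagRel neg ev k [] v' w' τ₁) ∨
        (v = Tm.inr a v' ∧ w = Tm.inr b w' ∧ FlagRel neg ev k [] v' w' τ₂)) := by
  cases h with
  | inl a b h =>
    cases hv with | inl _ hv =>
    cases hw with | inl _ hw =>
    exact ⟨_, _, _, _, ⟨hv, hw⟩, .inl ⟨rfl, rfl, h⟩⟩
  | inr a b h =>
    cases hv with | inr _ hv =>
    cases hw with | inr _ hw =>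
    exact ⟨_, _, _, _, ⟨hv, hw⟩, .inr ⟨rfl, rfl, h⟩⟩
  | var h => simp at h
  | _ => cases hv

theorem FlagRel.arr_inv {τ₁ τ₂ : Ty} (h : FlagRel neg ev k [] v w (Ty.arr τ₁ τ₂))
    (hv : Value v) :
    (∃ a b e f, v = Tm.lam a e ∧ w = Tm.lam b f ∧ FlagRel neg ev k [τ₁] e f τ₂) ∨
    (v = bflip neg ∧ w = iflip ∧ τ₁ = fldTy (Ty.var k) ∧ τ₂ = fldTy (Ty.var k)) ∨
    (v = bret ∧ w = iret ev ∧ τ₁ = fldTy (Ty.var k) ∧ τ₂ = Ty.bool) := by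
  cases h with
  | lam a b h => exact .inl ⟨a, b, _, _, rfl, rfl, h⟩
  | flip => exact .inr (.inl ⟨rfl, rfl, rfl, rfl⟩)
  | ret => exact .inr (.inr ⟨rfl, rfl, rfl, rfl⟩)
  | var h => simp at h
  | _ => cases hv

theorem FlagRel.all_inv {τ : Ty} (h : FlagRel neg ev k [] v w (Ty.all τ)) (hv : Value v) :
    ∃ e f, v = Tm.tlam e ∧ w = Tm.tlam f ∧ FlagRel neg ev (k + 1) [] e f τ := by
  cases h with
  | tlam h => exact ⟨_, _, rfl, rfl, h⟩
  | var h => simp at h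
  | _ => cases hv

theorem FlagRel.ex_inv {τ : Ty} (h : FlagRel neg ev k [] v w (Ty.ex τ)) (hv : Value v)
    (hw : Value w) : ∃ τ₁ a b a' b' v' w', v = Tm.pack a v' a' ∧ w = Tm.pack b w' b' ∧
      (Value v' ∧ Value w') ∧ FlagRel neg ev k [] v' w' (τ.inst τ₁) := by
  cases h with
  | pack τ₁ a b a' b' h =>
    cases hv with | pack _ _ hv =>
    cases hw with | pack _ _ hw =>
    exact ⟨τ₁, a, b, a', b', _, _, rfl, rfl, ⟨hv, hw⟩, h⟩
  | var h => simp at h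
  | _ => cases hv

theorem FlagRel.mu_inv {τ : Ty} (h : FlagRel neg ev k [] v w (Ty.mu τ)) (hv : Value v)
    (hw : Value w) : ∃ a b v' w', v = Tm.fold a v' ∧ w = Tm.fold b w' ∧
      (Value v' ∧ Value w') ∧ FlagRel neg ev k [] v' w' (τ.inst (Ty.mu τ)) := by
  cases h with
  | fold a b h =>
    cases hv with | fold _ hv =>
    cases hw with | fold _ hw =>
    exact ⟨a, b, _, _, rfl, rfl, ⟨hv, hw⟩, h⟩
  | var h => simp at h
  | _ => cases hv

/-- Related flag objects over the distinguished variable hold an integer `z` on the right and its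
parity on the left. -/
theorem FlagRel.fldTy_inv (h : FlagRel neg ev k [] v w (fldTy (Ty.var k))) (hv : Value v)
    (hw : Value w) : ∃ a b p q, ∃ z : ℤ,
      v = Tm.fold a (Tm.pair (Tm.bool (decide (Even z))) p) ∧
      w = Tm.fold b (Tm.pair (Tm.int z) q) ∧ (Value p ∧ Value q) ∧
      FlagRel neg ev k [] p q (Ty.prod (Ty.arr (fldTy (Ty.var k)) (fldTy (Ty.var k)))
        (Ty.arr (fldTy (Ty.var k)) Ty.bool)) := by
  obtain ⟨a, b, v', w', rfl, rfl, ⟨hv, hw⟩, h⟩ := FlagRel.mu_inv h hv hw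
  rw [← fldTy, fldTy_unfold] at h
  obtain ⟨s, p, t, q, rfl, rfl, ⟨hs, hp, -, hq⟩, h₁, h₂⟩ := h.prod_inv hv hw
  obtain ⟨z, rfl, rfl⟩ := h₁.var_inv hs
  exact ⟨a, b, p, q, z, rfl, rfl, ⟨hp, hq⟩, h₂⟩

end CanonicalForms

/-! ### Evaluation of the methods -/

theorem Step.app_inv {e v x : Tm} (hv : Value v) (h : Step (Tm.app e v) x) :
    Value e ∨ ∃ e', Step e e' ∧ x = Tm.app e' v := by
  generalize hu : Tm.app e v = u at h
  cases h with
  | fill E h =>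
    cases E with
    | hole =>
      rw [ECtx.fill] at hu
      subst hu
      cases h
      exact .inl (.lam _ _)
    | appL E e₂ =>
      simp only [ECtx.fill, Tm.app.injEq] at hu
      obtain ⟨rfl, rfl⟩ := hu
      exact .inr ⟨_, .fill E h, rfl⟩
    | appR v₁ hv₁ E =>
      simp only [ECtx.fill, Tm.app.injEq] at hu
      obtain ⟨rfl, rfl⟩ := hu
      exact .inl hv₁
    | _ => simp [ECtx.fill] at hu

/-- A function term need not be a value; an application of it to an unevaluated argument first
evaluates the function, then the argument. -/
theorem Evals.app_steps {e v u a : Tm} (hv : Value v) (h : Evals (Tm.app e v) u)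
    (ha : Relation.ReflTransGen Step a v) : Relation.ReflTransGen Step (Tm.app e a) u := by
  obtain ⟨hs, hu⟩ := h
  generalize hx : Tm.app e v = x at hs
  induction hs using Relation.ReflTransGen.head_induction_on generalizing e with
  | refl => subst hx; cases hu
  | head h hs ih =>
    subst hx
    rcases h.app_inv hv with he | ⟨e', he, rfl⟩
    · exact (steps_inCtx (.appR e he .hole) ha).trans (hs.head h)
    · exact (ih rfl).head (he.inCtx (.appL .hole a))

theorem fst_unfold_steps {a : Ty} {s p : Tm} (hs : Value s) (hp : Value p) :
    Relation.ReflTransGen Step (Tm.fst (Tm.unfold (Tm.fold a (Tm.pair s p)))) s :=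
  .head (.fill (.fst .hole) (.unfold a (.pair hs hp))) (.single (Head.fst hs hp).step)

theorem snd_unfold_steps {a : Ty} {s p : Tm} (hs : Value s) (hp : Value p) :
    Relation.ReflTransGen Step (Tm.snd (Tm.unfold (Tm.fold a (Tm.pair s p)))) p :=
  .head (.fill (.snd .hole) (.unfold a (.pair hs hp))) (.single (Head.snd hs hp).step)

theorem bflip_steps {neg : Tm} (hn : ImplementsNot neg) {a : Ty} {b : Bool} {p : Tm}
    (hp : Value p) :
    Relation.TransGen Step (Tm.app (bflip neg) (Tm.fold a (Tm.pair (Tm.bool b) p)))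
      (Tm.fold (fldTy Ty.bool) (Tm.pair (Tm.bool !b) p)) := by
  refine .head' (Head.beta _ _ (.fold a (.pair (.bool b) hp))).step ?_
  simp only [Tm.inst, Tm.subst, scons, hn.1.subst_eq (fun _ h => absurd h (Nat.not_lt_zero _))]
  exact (steps_inCtx (.fold _ (.pairL .hole _))
      ((hn.2 b).app_steps (.bool b) (fst_unfold_steps (.bool b) hp))).trans
    (steps_inCtx (.fold _ (.pairR _ (.bool !b) .hole)) (snd_unfold_steps (.bool b) hp))

theorem iflip_steps {a : Ty} {z : ℤ} {p : Tm} (hp : Value p) :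
    Relation.TransGen Step (Tm.app iflip (Tm.fold a (Tm.pair (Tm.int z) p)))
      (Tm.fold (fldTy Ty.int) (Tm.pair (Tm.int (1 + z)) p)) := by
  refine .head' (Head.beta _ _ (.fold a (.pair (.int z) hp))).step ?_
  simp only [Tm.inst, Tm.subst, scons]
  exact ((steps_inCtx (.fold _ (.pairL (.opR .add _ (.int 1) .hole) _))
      (fst_unfold_steps (.int z) hp)).tail
      (.fill (.fold _ (.pairL .hole _)) (.op .add 1 z))).trans
    (steps_inCtx (.fold _ (.pairR _ (.int (1 + z)) .hole)) (snd_unfold_steps (.int z) hp))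

theorem bret_steps {a : Ty} {b : Bool} {p : Tm} (hp : Value p) :
    Relation.TransGen Step (Tm.app bret (Tm.fold a (Tm.pair (Tm.bool b) p))) (Tm.bool b) :=
  .head' (Head.beta _ _ (.fold a (.pair (.bool b) hp))).step (fst_unfold_steps (.bool b) hp)

theorem iret_steps {ev : Tm} (he : ImplementsEven ev) {a : Ty} {z : ℤ} {p : Tm} (hp : Value p) :
    Relation.TransGen Step (Tm.app (iret ev) (Tm.fold a (Tm.pair (Tm.int z) p)))
      (Tm.bool (decide (Even z))) := by
  refine .head' (Head.beta _ _ (.fold a (.pair (.int z) hp))).step ?_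
  simp only [Tm.inst, Tm.subst, scons, he.1.subst_eq (fun _ h => absurd h (Nat.not_lt_zero _))]
  exact (he.2 z).app_steps (.int z) (fst_unfold_steps (.int z) hp)

/-! ### The simulation -/

/-- Progress and preservation for related closed terms, on both sides at once. A step of the typed
common skeleton costs at least one step on each side, and exactly one except in a call of `flip`
or `ret`, where the two methods run to completion. -/
theorem FlagRel.simulation {neg ev : Tm} (hn : ImplementsNot neg) (he : ImplementsEven ev)
    {k : ℕ} {e f : Tm} {τ : Ty} (h : FlagRel neg ev k [] e f τ) :
    (Value e ∧ Value f) ∨ ∃ e' f', Relation.TransGen Step e e' ∧ Relation.TransGen Step f f' ∧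
      FlagRel neg ev k [] e' f' τ := by
  generalize hΓ : ([] : List Ty) = Γ at h
  induction h with
  | state z => exact .inl ⟨.bool _, .int z⟩
  | flip => exact .inl ⟨.lam _ _, .lam _ _⟩
  | ret => exact .inl ⟨.lam _ _, .lam _ _⟩
  | var h => subst hΓ; simp at h
  | unit => exact .inl ⟨.unit, .unit⟩
  | int z => exact .inl ⟨.int z, .int z⟩
  | bool b => exact .inl ⟨.bool b, .bool b⟩
  | op o h₁ h₂ hτ ih₁ ih₂ =>
    subst hΓ
    right
    rcases ih₁ rfl with ⟨hv₁, hw₁⟩ | ⟨e', f', hs, ht, h⟩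
    · rcases ih₂ rfl with ⟨hv₂, hw₂⟩ | ⟨e', f', hs, ht, h⟩
      · obtain ⟨x, rfl, rfl⟩ := h₁.int_inv hv₁
        obtain ⟨y, rfl, rfl⟩ := h₂.int_inv hv₂
        refine ⟨_, _, .single (Head.op o x y).step, .single (Head.op o x y).step, ?_⟩
        subst hτ
        cases o <;> constructor
      · exact ⟨_, _, steps1_inCtx (.opR o _ hv₁ .hole) hs, steps1_inCtx (.opR o _ hw₁ .hole) ht,
          .op o h₁ h hτ⟩
    · exact ⟨_, _, steps1_inCtx (.opL o .hole _) hs, steps1_inCtx (.opL o .hole _) ht,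
        .op o h h₂ hτ⟩
  | ite h h₁ h₂ ih =>
    subst hΓ
    right
    rcases ih rfl with ⟨hv, hw⟩ | ⟨e', f', hs, ht, h⟩
    · obtain ⟨b, rfl, rfl⟩ := h.bool_inv hv
      cases b
      · exact ⟨_, _, .single (Head.iteFalse _ _).step, .single (Head.iteFalse _ _).step, h₂⟩
      · exact ⟨_, _, .single (Head.iteTrue _ _).step, .single (Head.iteTrue _ _).step, h₁⟩
    · exact ⟨_, _, steps1_inCtx (.ite .hole _ _) hs, steps1_inCtx (.ite .hole _ _) ht,
        .ite h h₁ h₂⟩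
  | pair h₁ h₂ ih₁ ih₂ =>
    subst hΓ
    rcases ih₁ rfl with ⟨hv₁, hw₁⟩ | ⟨e', f', hs, ht, h⟩
    · rcases ih₂ rfl with ⟨hv₂, hw₂⟩ | ⟨e', f', hs, ht, h⟩
      · exact .inl ⟨.pair hv₁ hv₂, .pair hw₁ hw₂⟩
      · exact .inr ⟨_, _, steps1_inCtx (.pairR _ hv₁ .hole) hs,
          steps1_inCtx (.pairR _ hw₁ .hole) ht, .pair h₁ h⟩
    · exact .inr ⟨_, _, steps1_inCtx (.pairL .hole _) hs, steps1_inCtx (.pairL .hole _) ht,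
        .pair h h₂⟩
  | fst h ih =>
    subst hΓ
    right
    rcases ih rfl with ⟨hv, hw⟩ | ⟨e', f', hs, ht, h⟩
    · obtain ⟨v₁, v₂, w₁, w₂, rfl, rfl, ⟨hv₁, hv₂, hw₁, hw₂⟩, h₁, h₂⟩ := h.prod_inv hv hw
      exact ⟨_, _, .single (Head.fst hv₁ hv₂).step, .single (Head.fst hw₁ hw₂).step, h₁⟩
    · exact ⟨_, _, steps1_inCtx (.fst .hole) hs, steps1_inCtx (.fst .hole) ht, .fst h⟩
  | snd h ih =>
    subst hΓ
    right
    rcases ih rfl with ⟨hv, hw⟩ | ⟨e', f', hs, ht, h⟩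
    · obtain ⟨v₁, v₂, w₁, w₂, rfl, rfl, ⟨hv₁, hv₂, hw₁, hw₂⟩, h₁, h₂⟩ := h.prod_inv hv hw
      exact ⟨_, _, .single (Head.snd hv₁ hv₂).step, .single (Head.snd hw₁ hw₂).step, h₂⟩
    · exact ⟨_, _, steps1_inCtx (.snd .hole) hs, steps1_inCtx (.snd .hole) ht, .snd h⟩
  | inl a b h ih =>
    subst hΓ
    rcases ih rfl with ⟨hv, hw⟩ | ⟨e', f', hs, ht, h⟩
    · exact .inl ⟨.inl a hv, .inl b hw⟩
    · exact .inr ⟨_, _, steps1_inCtx (.inl a .hole) hs, steps1_inCtx (.inl b .hole) ht,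
        .inl a b h⟩
  | inr a b h ih =>
    subst hΓ
    rcases ih rfl with ⟨hv, hw⟩ | ⟨e', f', hs, ht, h⟩
    · exact .inl ⟨.inr a hv, .inr b hw⟩
    · exact .inr ⟨_, _, steps1_inCtx (.inr a .hole) hs, steps1_inCtx (.inr b .hole) ht,
        .inr a b h⟩
  | case h h₁ h₂ ih =>
    subst hΓ
    right
    rcases ih rfl with ⟨hv, hw⟩ | ⟨e', f', hs, ht, h⟩
    · obtain ⟨a, b, v, w, ⟨hv', hw'⟩, ⟨rfl, rfl, h'⟩ | ⟨rfl, rfl, h'⟩⟩ := h.sum_inv hv hw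
      · exact ⟨_, _, .single (Head.caseInl _ _ _ hv').step, .single (Head.caseInl _ _ _ hw').step,
          h₁.inst hn.1 he.1 h'⟩
      · exact ⟨_, _, .single (Head.caseInr _ _ _ hv').step, .single (Head.caseInr _ _ _ hw').step,
          h₂.inst hn.1 he.1 h'⟩
    · exact ⟨_, _, steps1_inCtx (.case .hole _ _) hs, steps1_inCtx (.case .hole _ _) ht,
        .case h h₁ h₂⟩
  | lam a b => exact .inl ⟨.lam _ _, .lam _ _⟩
  | app h₁ h₂ ih₁ ih₂ =>
    subst hΓ
    right
    rcases ih₁ rfl with ⟨hv₁, hw₁⟩ | ⟨e', f', hs, ht, h⟩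
    · rcases ih₂ rfl with ⟨hv₂, hw₂⟩ | ⟨e', f', hs, ht, h⟩
      · rcases h₁.arr_inv hv₁ with ⟨a, b, e, f, rfl, rfl, h⟩ | ⟨rfl, rfl, rfl, rfl⟩ |
          ⟨rfl, rfl, rfl, rfl⟩
        · exact ⟨_, _, .single (Head.beta _ _ hv₂).step, .single (Head.beta _ _ hw₂).step,
            h.inst hn.1 he.1 h₂⟩
        · obtain ⟨a, b, p, q, z, rfl, rfl, ⟨hp, hq⟩, h⟩ := h₂.fldTy_inv hv₂ hw₂
          refine ⟨_, _, bflip_steps hn hp, iflip_steps hq, .fold _ _ ?_⟩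
          rw [← fldTy, fldTy_unfold]
          refine .pair ?_ h
          have hz : (!decide (Even z)) = decide (Even (1 + z)) := by
            rw [← decide_not, decide_eq_decide, add_comm, Int.even_add_one]
          rw [hz]
          exact .state (1 + z)
        · obtain ⟨a, b, p, q, z, rfl, rfl, ⟨hp, hq⟩, h⟩ := h₂.fldTy_inv hv₂ hw₂
          exact ⟨_, _, bret_steps hp, iret_steps he hq, .bool _⟩
      · exact ⟨_, _, steps1_inCtx (.appR _ hv₁ .hole) hs, steps1_inCtx (.appR _ hw₁ .hole) ht,
          .app h₁ h⟩
    · exact ⟨_, _, steps1_inCtx (.appL .hole _) hs, steps1_inCtx (.appL .hole _) ht, .app h h₂⟩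
  | tlam => exact .inl ⟨.tlam _, .tlam _⟩
  | tapp τ₁ a b h hτ ih =>
    subst hΓ
    right
    rcases ih rfl with ⟨hv, hw⟩ | ⟨e', f', hs, ht, h⟩
    · obtain ⟨e, f, rfl, rfl, h'⟩ := h.all_inv hv
      exact ⟨_, _, .single (Head.tbeta _ _).step, .single (Head.tbeta _ _).step,
        hτ ▸ h'.instTy hn.1 he.1 τ₁ a b⟩
    · exact ⟨_, _, steps1_inCtx (.tapp .hole a) hs, steps1_inCtx (.tapp .hole b) ht,
        .tapp τ₁ a b h hτ⟩
  | pack τ₁ a b a' b' h ih =>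
    subst hΓ
    rcases ih rfl with ⟨hv, hw⟩ | ⟨e', f', hs, ht, h⟩
    · exact .inl ⟨.pack a a' hv, .pack b b' hw⟩
    · exact .inr ⟨_, _, steps1_inCtx (.pack a .hole a') hs, steps1_inCtx (.pack b .hole b') ht,
        .pack τ₁ a b a' b' h⟩
  | unpack h₁ h₂ ih =>
    subst hΓ
    right
    rcases ih rfl with ⟨hv, hw⟩ | ⟨e', f', hs, ht, h⟩
    · obtain ⟨τ₁, a, b, a', b', v, w, rfl, rfl, ⟨hv, hw⟩, h⟩ := h₁.ex_inv hv hw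
      have h₃ := h₂.instTy hn.1 he.1 τ₁ a b
      rw [Ty.shift_inst] at h₃
      exact ⟨_, _, .single (Head.unpack _ _ _ hv).step, .single (Head.unpack _ _ _ hw).step,
        h₃.inst hn.1 he.1 h⟩
    · exact ⟨_, _, steps1_inCtx (.unpack .hole _) hs, steps1_inCtx (.unpack .hole _) ht,
        .unpack h h₂⟩
  | fold a b h ih =>
    subst hΓ
    rcases ih rfl with ⟨hv, hw⟩ | ⟨e', f', hs, ht, h⟩
    · exact .inl ⟨.fold a hv, .fold b hw⟩
    · exact .inr ⟨_, _, steps1_inCtx (.fold a .hole) hs, steps1_inCtx (.fold b .hole) ht,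
        .fold a b h⟩
  | unfold h hτ ih =>
    subst hΓ
    right
    rcases ih rfl with ⟨hv, hw⟩ | ⟨e', f', hs, ht, h⟩
    · obtain ⟨a, b, v, w, rfl, rfl, ⟨hv, hw⟩, h⟩ := h.mu_inv hv hw
      exact ⟨_, _, .single (Head.unfold _ hv).step, .single (Head.unfold _ hw).step, hτ ▸ h⟩
    · exact ⟨_, _, steps1_inCtx (.unfold .hole) hs, steps1_inCtx (.unfold .hole) ht,
        .unfold h hτ⟩

/-! ### Contextual equivalence -/

theorem flags_ctxEquiv {neg ev : Tm} (hn : ImplementsNot neg) (he : ImplementsEven ev) :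
    CtxEquiv (bflag neg) (iflag ev) flagTy := by
  refine ⟨⟨bflag_hasType hn.1, iflag_hasType he.1⟩, fun C τ hC ht => ?_, fun C τ hC ht => ?_⟩
  · exact ht.of_simulation (R := fun e f => FlagRel neg ev 0 [] e f τ)
      (fun _ _ h => h.simulation hn he) (hC.flagRel 0)
  · refine ht.of_simulation (R := fun f e => FlagRel neg ev 0 [] e f τ)
      (fun _ _ h => ?_) (hC.flagRel 0)
    rcases h.simulation hn he with ⟨hv, hw⟩ | ⟨e', f', hs, ht, h'⟩
    · exact .inl ⟨hw, hv⟩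
    · exact .inr ⟨f', e', ht, hs, h'⟩

/-! ### Implementations of negation and parity -/

theorem implementsNot_notTm : ImplementsNot notTm := by
  refine ⟨.lam trivial (.ite (.var rfl) (.bool _) (.bool _)), fun b => ⟨?_, .bool _⟩⟩
  refine .head (Head.beta _ _ (.bool b)).step (.single ?_)
  cases b
  · exact (Head.iteFalse _ _).step
  · exact (Head.iteTrue _ _).step

theorem evenBody_hasType : HasType 0 [] evenBody (Ty.arr selfTy (Ty.arr Ty.int Ty.bool)) := by
  have hx : HasType 0 [Ty.int, selfTy] (Tm.var 0) Ty.int := .var rfl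
  have hf : HasType 0 [Ty.int, selfTy] (Tm.var 1) selfTy := .var rfl
  have hrec : HasType 0 [Ty.int, selfTy] (Tm.app (Tm.unfold (Tm.var 1)) (Tm.var 1))
      (Ty.arr Ty.int Ty.bool) := .app (.unfold hf) hf
  exact .lam ⟨Nat.one_pos, trivial, trivial⟩ (.lam trivial
    (.ite (.op .eq hx (.int 0)) (.bool _) (.ite (.op .eq hx (.int 1)) (.bool _)
      (.ite (.op .lt hx (.int 0)) (.app hrec (.op .add hx (.int 2)))
        (.app hrec (.op .sub hx (.int 2)))))))

theorem evenTm_hasType : HasType 0 [] evenTm (Ty.arr Ty.int Ty.bool) := by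
  have h : HasType 0 [Ty.int] evenBody _ := evenBody_hasType.weaken [Ty.int]
  exact .lam trivial (.app (.app h (.fold h ⟨Nat.one_pos, trivial, trivial⟩)) (.var rfl))

/-- The body of the recursive function at the argument `e`, with the recursion tied. -/
def evenAt (e : Tm) : Tm :=
  let recur := Tm.app (Tm.unfold (Tm.fold selfTy evenBody)) (Tm.fold selfTy evenBody)
  Tm.ite (Tm.op PrimOp.eq e (Tm.int 0)) (Tm.bool true)
    (Tm.ite (Tm.op PrimOp.eq e (Tm.int 1)) (Tm.bool false)
      (Tm.ite (Tm.op PrimOp.lt e (Tm.int 0))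
        (Tm.app recur (Tm.op PrimOp.add e (Tm.int 2)))
        (Tm.app recur (Tm.op PrimOp.sub e (Tm.int 2)))))

theorem value_fold_evenBody : Value (Tm.fold selfTy evenBody) := .fold _ (.lam _ _)

theorem app_evenBody_step : Step (Tm.app evenBody (Tm.fold selfTy evenBody))
    (Tm.lam Ty.int (evenAt (Tm.var 0))) :=
  (Head.beta _ _ value_fold_evenBody).step

theorem rec_steps {e : Tm} {z : ℤ} (h : Step e (Tm.int z)) :
    Relation.ReflTransGen Step
      (Tm.app (Tm.app (Tm.unfold (Tm.fold selfTy evenBody)) (Tm.fold selfTy evenBody)) e)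
      (evenAt (Tm.int z)) :=
  .head (.fill (.appL (.appL .hole _) _) (.unfold _ (.lam _ _)))
    (.head (app_evenBody_step.inCtx (.appL .hole _))
      (.head (h.inCtx (.appR _ (.lam _ _) .hole)) (.single (Head.beta _ _ (.int z)).step)))

theorem ite_op_steps (o : PrimOp) (x y : ℤ) (b : Bool) (e₁ e₂ : Tm) (h : o.eval x y = Tm.bool b) :
    Relation.ReflTransGen Step (Tm.ite (Tm.op o (Tm.int x) (Tm.int y)) e₁ e₂)
      (if b then e₁ else e₂) := by
  refine .head (.fill (.ite .hole _ _) (.op o x y)) (.single ?_)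
  change Step (Tm.ite (o.eval x y) e₁ e₂) _
  rw [h]
  cases b
  · exact (Head.iteFalse _ _).step
  · exact (Head.iteTrue _ _).step

theorem evenAt_steps (z : ℤ) :
    Relation.ReflTransGen Step (evenAt (Tm.int z)) (Tm.bool (decide (Even z))) := by
  -- `|2 z - 1|` decreases in each recursive call; `|z|` does not, as `-1` calls `1`.
  induction hm : (2 * z - 1).natAbs using Nat.strong_induction_on generalizing z with
  | _ m ih =>
    refine (ite_op_steps .eq z 0 _ _ _ rfl).trans ?_
    by_cases h₀ : z = 0
    · subst h₀; exact .refl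
    rw [if_neg (by simpa using h₀)]
    refine (ite_op_steps .eq z 1 _ _ _ rfl).trans ?_
    by_cases h₁ : z = 1
    · subst h₁; exact .refl
    rw [if_neg (by simpa using h₁)]
    refine (ite_op_steps .lt z 0 _ _ _ rfl).trans ?_
    by_cases h₂ : z < 0
    · rw [if_pos (by simpa using h₂)]
      refine (rec_steps (Head.op .add z 2).step).trans ?_
      have hz : Even (z + 2) ↔ Even z := by simp
      have := ih (2 * (z + 2) - 1).natAbs (by omega) (z + 2) rfl
      rwa [decide_eq_decide.2 hz] at this
    · rw [if_neg (by simpa using h₂)]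
      refine (rec_steps (Head.op .sub z 2).step).trans ?_
      have hz : Even (z - 2) ↔ Even z := by simp
      have := ih (2 * (z - 2) - 1).natAbs (by omega) (z - 2) rfl
      rwa [decide_eq_decide.2 hz] at this

theorem implementsEven_evenTm : ImplementsEven evenTm := by
  refine ⟨evenTm_hasType, fun z => ⟨?_, .bool _⟩⟩
  refine .head (Head.beta _ _ (.int z)).step ?_
  exact .head (app_evenBody_step.inCtx (.appL .hole (Tm.int z)))
    (.head (Head.beta _ _ (.int z)).step (evenAt_steps z))

end FMu

theorem mainTheorem10 :
    (FMu.ImplementsNot FMu.notTm ∧ FMu.ImplementsEven FMu.evenTm) ∧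
      ∀ (neg ev : FMu.Tm), FMu.ImplementsNot neg → FMu.ImplementsEven ev →
        FMu.CtxEquiv (FMu.bflag neg) (FMu.iflag ev) FMu.flagTy :=
  ⟨⟨FMu.implementsNot_notTm, FMu.implementsEven_evenTm⟩, fun _ _ => FMu.flags_ctxEquiv⟩
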